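/- Conventions. $\omega=\{0,1,2,\dots\}$. A semitopological semigroup is a semigroup with a topology for which the multiplication is separately continuous. A topological inverse semigroup is a semigroup with a topology in which every element $x$ has a unique inverse $x^{-1}$ (that is, $xx^{-1}x=x$ and $x^{-1}xx^{-1}=x^{-1}$) and both the multiplication (jointly) and the inversion are continuous. A $0$-simple inverse $\omega$-semigroup is an inverse semigroup $S$ with zero $\mathbf 0$ such that $\{\mathbf 0\}$ is the unique proper two-sided ideal of $S$ and the set $E(S)\setminus\{\mathbf 0\}$ of nonzero idempotents, ordered by $e\preccurlyeq f\iff ef=fe=e$, is order isomorphic to $(\omega,\geqslant)$. A finite semilattice of compact groups $T=[E;G_\alpha,\varphi_{\alpha,\beta}]$ is given by a finite semilattice $E$, compact Hausdorff topological groups $G_\alpha$ ($\alpha\in E$) and homomorphisms $\varphi_{\alpha,\beta}\colon G_\alpha\to G_\beta$ ($\beta\preccurlyeq\alpha$) with $\varphi_{\alpha,\alpha}=\mathrm{id}$ and such that $\varphi_{\alpha,\beta}$ followed by $\varphi_{\beta,\gamma}$ is $\varphi_{\alpha,\gamma}$; $T$ is the disjoint union of the $G_\alpha$ with the topological sum topology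 and with the product $a*b=\varphi_{\alpha,\alpha\beta}(a)\,\varphi_{\beta,\alpha\beta}(b)$ for $a\in G_\alpha$, $b\in G_\beta$. If $E$ has a greatest element, $T$ is a monoid. For a monoid $T$ and a homomorphism $\theta$ of $T$ into its group of units, the Bruck--Reilly extension $\mathbf{BR}(T,\theta)$ is $\omega\times T\times\omega$ with $$(i,s,j)(k,t,l)=\bigl(i+k-\min\{j,k\},\ \theta^{k-\min\{j,k\}}(s)\,\theta^{j-\min\{j,k\}}(t),\ j+l-\min\{j,k\}\bigr),$$ and $\mathbf{BR}^{\mathbf 0}(T,\theta)$ is $\mathbf{BR}(T,\theta)$ with an adjoined zero. If $T$ is a topological space, the sum direct topology $\tau^{\oplus}_{\mathbf{BR}}$ on $\mathbf{BR}(T,\theta)$ is the one generated by the sets $\{(i,s,j):s\in U\}$ with $U\subseteq T$ open and $i,j\in\omega$. Theorem 3.14. Let $S$ be a Hausdorff semitopological $0$-simple inverse $\omega$-semigroup such that every maximal subgroup of $S$ is compact. Then there are a finite semilattice of compact groups $T=[E;G_\alpha,\varphi_{\alpha,\beta}]$, where $E$ has a greatest element, a homomorphism $\theta$ from $T$ into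 its group of units, and a topology $\tau^{\mathbf 0}_{\mathbf{BR}}$ on $\mathbf{BR}^{\mathbf 0}(T,\theta)$ such that 1. $S$ is topologically isomorphic to $(\mathbf{BR}^{\mathbf 0}(T,\theta),\tau^{\mathbf 0}_{\mathbf{BR}})$; 2. $\tau^{\mathbf 0}_{\mathbf{BR}}$ induces on $\mathbf{BR}(T,\theta)$ the sum direct topology $\tau^{\oplus}_{\mathbf{BR}}$; 3. $(\mathbf{BR}(T,\theta),\tau^{\oplus}_{\mathbf{BR}})$ is a topological Bruck--Reilly extension of $T$ in the class of Hausdorff topological inverse semigroups, i.e. $T$ and $(\mathbf{BR}(T,\theta),\tau^{\oplus}_{\mathbf{BR}})$ are Hausdorff topological inverse semigroups and, for some $i\in\omega$, the map $t\mapsto(i,t,i)$ is a homeomorphism of $T$ onto the subspace $\{i\}\times T\times\{i\}$ of $\mathbf{BR}(T,\theta)$. 4. If moreover the space $S$ is locally compact, then either the space $(\mathbf{BR}^{\mathbf 0}(T,\theta),\tau^{\mathbf 0}_{\mathbf{BR}})$ is compact, or every $\mathscr H$-class of $\mathbf{BR}^{\mathbf 0}(T,\theta)$ is open and compact in it. 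-/

import Mathlib

universe u v

namespace OmegaSemigroup

section Semigroups

/-- `y` is an inverse of `x` in the sense of semigroup theory. -/
def IsInverseOf {S : Type u} [Mul S] (x y : S) : Prop :=
  x * y * x = x ∧ y * x * y = y

/-- A semigroup is inverse if every element has exactly one inverse. -/
def IsInverseSemigroup (S : Type u) [Semigroup S] : Prop :=
  ∀ x : S, ∃! y : S, IsInverseOf x y

/-- The natural partial order on idempotents: `e ≼ f` iff `ef = fe = e`. -/
def IdemLE {S : Type u} [Mul S] (e f : S) : Prop :=
  e * f = e ∧ f * e = e

/-- Two-sided ideals of a semigroup (nonempty, as usual). -/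
def IsTwoSidedIdeal {S : Type u} [Mul S] (I : Set S) : Prop :=
  I.Nonempty ∧ ∀ s : S, ∀ x ∈ I, s * x ∈ I ∧ x * s ∈ I

/-- A semigroup with zero is `0`-simple if `{0}` is its unique proper two-sided ideal. -/
def IsZeroSimple (S : Type u) [SemigroupWithZero S] : Prop :=
  ∀ I : Set S, IsTwoSidedIdeal I → (I ≠ Set.univ ↔ I = {0})

/-- The set `E(S) \ {0}`. -/
def NonzeroIdem (S : Type u) [SemigroupWithZero S] : Type u :=
  {e : S // IsIdempotentElem e ∧ e ≠ 0}

/-- `0`-simple inverse `ω`-semigroups: inverse, `0`-simple, and `E(S) \ {0}` with the natural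
partial order is order isomorphic to `(ω, ≥)`. -/
structure IsZeroSimpleInverseOmegaSemigroup (S : Type u) [SemigroupWithZero S] : Prop where
  inverse : IsInverseSemigroup S
  zeroSimple : IsZeroSimple S
  omega : Nonempty
    ((fun e f : NonzeroIdem S => IdemLE e.1 f.1) ≃r ((· ≥ ·) : ℕ → ℕ → Prop))

/-- A subset of a semigroup which is a group under the restricted operation. -/
def IsSubgroupSet {S : Type u} [Mul S] (A : Set S) : Prop :=
  (∀ x ∈ A, ∀ y ∈ A, x * y ∈ A) ∧
    ∃ e ∈ A, (∀ x ∈ A, e * x = x ∧ x * e = x) ∧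
      ∀ x ∈ A, ∃ y ∈ A, x * y = e ∧ y * x = e

/-- Maximal subgroups: subgroups not properly contained in another subgroup. -/
def IsMaximalSubgroup {S : Type u} [Mul S] (A : Set S) : Prop :=
  Maximal IsSubgroupSet A

/-- The principal left ideal `S¹a`. -/
def leftIdeal {S : Type u} [Mul S] (a : S) : Set S := {x | x = a ∨ ∃ s, x = s * a}

/-- The principal right ideal `aS¹`. -/
def rightIdeal {S : Type u} [Mul S] (a : S) : Set S := {x | x = a ∨ ∃ s, x = a * s}

/-- The class of `a` for Green's relation `ℋ = ℒ ∩ ℛ`. -/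
def hClass {S : Type u} [Mul S] (a : S) : Set S :=
  {b | leftIdeal b = leftIdeal a ∧ rightIdeal b = rightIdeal a}

/-- Topological inverse semigroups: every element has a unique inverse, and multiplication
(jointly) and inversion are continuous. -/
def IsTopologicalInverseSemigroup (S : Type u) [Semigroup S] [TopologicalSpace S] : Prop :=
  ContinuousMul S ∧
    ∃ inv : S → S, Continuous inv ∧ ∀ x y : S, IsInverseOf x y ↔ y = inv x

end Semigroups

section StrongSemilattice

/-- The connecting homomorphisms `φ_{α,β} : G_α → G_β`, for `β ≤ α`, of a strong semilattice
of groups. -/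
structure ConnectingHoms (E : Type v) [SemilatticeInf E] (G : E → Type u)
    [∀ α, Group (G α)] where
  map : ∀ {α β : E}, β ≤ α → (G α →* G β)
  map_self : ∀ (α : E) (x : G α), map (le_refl α) x = x
  map_map : ∀ {α β γ : E} (h : β ≤ α) (k : γ ≤ β) (x : G α),
    map k (map h x) = map (k.trans h) x

variable {E : Type v} [SemilatticeInf E] {G : E → Type u} [∀ α, Group (G α)]

/-- The strong semilattice of groups `[E; G_α, φ_{α,β}]`: the disjoint union of the `G_α`. -/
def StrongSemilattice (_φ : ConnectingHoms E G) : Type (max v u) := Σ α, G α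

namespace StrongSemilattice

variable {φ : ConnectingHoms E G}

/-- `a * b = φ_{α,αβ}(a) φ_{β,αβ}(b)` for `a ∈ G_α`, `b ∈ G_β`. -/
instance : Mul (StrongSemilattice φ) where
  mul a b := ⟨a.1 ⊓ b.1, φ.map inf_le_left a.2 * φ.map inf_le_right b.2⟩

theorem mul_def (a b : StrongSemilattice φ) :
    a * b = ⟨a.1 ⊓ b.1, φ.map inf_le_left a.2 * φ.map inf_le_right b.2⟩ := rfl

theorem ext' {a b : StrongSemilattice φ} (h : a.1 = b.1)
    (h2 : φ.map h.ge a.2 = b.2) : a = b := by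
  obtain ⟨α, x⟩ := a
  obtain ⟨β, y⟩ := b
  obtain rfl : α = β := h
  rw [φ.map_self] at h2
  exact congrArg (Sigma.mk α) h2

/-- If `E` has a greatest element `⊤` then the identity of `G_⊤` is the identity. -/
instance [OrderTop E] : Monoid (StrongSemilattice φ) where
  one := ⟨⊤, 1⟩
  mul_assoc a b c := by
    refine ext' (inf_assoc a.1 b.1 c.1) ?_
    change φ.map _ (φ.map _ (φ.map _ a.2 * φ.map _ b.2) * φ.map _ c.2) =
      φ.map _ a.2 * φ.map _ (φ.map _ b.2 * φ.map _ c.2)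
    simp only [map_mul, φ.map_map, mul_assoc]
  one_mul a := by
    refine ext' (top_inf_eq a.1) ?_
    change φ.map _ (φ.map _ 1 * φ.map _ a.2) = a.2
    simp only [map_one, one_mul, φ.map_map, φ.map_self]
  mul_one a := by
    refine ext' (inf_top_eq a.1) ?_
    change φ.map _ (φ.map _ a.2 * φ.map _ 1) = a.2
    simp only [map_one, mul_one, φ.map_map, φ.map_self]

/-- The topology of the topological sum of the `G_α`. -/
instance [∀ α, TopologicalSpace (G α)] : TopologicalSpace (StrongSemilattice φ) :=
  inferInstanceAs (TopologicalSpace (Σ α, G α))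

end StrongSemilattice

end StrongSemilattice

section BruckReilly

/-- The underlying set `ω × T × ω` of the Bruck--Reilly extension `BR(T, θ)` of a monoid `T`,
where `θ` is a homomorphism from `T` into its group of units. -/
@[ext]
structure BruckReilly {T : Type u} [Monoid T] (θ : T →* Tˣ) : Type u where
  fst : ℕ
  mid : T
  snd : ℕ

namespace BruckReilly

variable {T : Type u} [Monoid T] {θ : T →* Tˣ}

/-- The iterate `θⁿ : T → T`, with `θ⁰` the identity. -/
def iter (θ : T →* Tˣ) (n : ℕ) : T → T := (fun t => ((θ t : Tˣ) : T))^[n]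

/-- `(i,s,j)(k,t,l) = (i+k-min{j,k}, θ^{k-min{j,k}}(s) θ^{j-min{j,k}}(t), j+l-min{j,k})`. -/
instance : Mul (BruckReilly θ) where
  mul a b :=
    ⟨a.fst + b.fst - min a.snd b.fst,
      iter θ (b.fst - min a.snd b.fst) a.mid * iter θ (a.snd - min a.snd b.fst) b.mid,
      a.snd + b.snd - min a.snd b.fst⟩

theorem mul_def (a b : BruckReilly θ) : a * b =
    ⟨a.fst + b.fst - min a.snd b.fst,
      iter θ (b.fst - min a.snd b.fst) a.mid * iter θ (a.snd - min a.snd b.fst) b.mid,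
      a.snd + b.snd - min a.snd b.fst⟩ := rfl

theorem iter_mul (n : ℕ) (s t : T) : iter θ n (s * t) = iter θ n s * iter θ n t := by
  unfold iter
  induction n generalizing s t with
  | zero => rfl
  | succ n ih => simp only [Function.iterate_succ_apply, map_mul, Units.val_mul, ih]

theorem iter_iter (m n : ℕ) (t : T) : iter θ m (iter θ n t) = iter θ (m + n) t :=
  (Function.iterate_add_apply _ m n t).symm

instance : Semigroup (BruckReilly θ) where
  mul_assoc a b c := by
    obtain ⟨i, s, j⟩ := a
    obtain ⟨k, t, l⟩ := b
    obtain ⟨m, r, n⟩ := c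
    simp only [mul_def, iter_mul, iter_iter, mul_assoc, mk.injEq]
    refine ⟨by omega, ?_, by omega⟩
    congr 1
    · congr 1; omega
    · congr 1
      · congr 1; omega
      · congr 1; omega

/-- The set `A_{i,j} = {(i,s,j) : s ∈ A}`. -/
def block (θ : T →* Tˣ) (A : Set T) (i j : ℕ) : Set (BruckReilly θ) :=
  {x | x.fst = i ∧ x.mid ∈ A ∧ x.snd = j}

/-- The sum direct topology: generated by the sets `U_{i,j}` with `U` open in `T`. -/
@[reducible]
def sumDirectTopology [TopologicalSpace T] (θ : T →* Tˣ) : TopologicalSpace (BruckReilly θ) :=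
  TopologicalSpace.generateFrom {V | ∃ U : Set T, IsOpen U ∧ ∃ i j : ℕ, V = block θ U i j}

/-- A topology on `BR(T, θ)` makes it a topological Bruck--Reilly extension of the topological
monoid `T` in the class of Hausdorff topological inverse semigroups: both belong to this class
and, for some `i`, the map `t ↦ (i,t,i)` is a homeomorphism of `T` onto the subspace `T_{i,i}`
of `BR(T, θ)`. -/
def IsTopologicalExtension [TopologicalSpace T] (θ : T →* Tˣ)
    [TopologicalSpace (BruckReilly θ)] : Prop :=
  (T2Space T ∧ IsTopologicalInverseSemigroup T) ∧
    (T2Space (BruckReilly θ) ∧ IsTopologicalInverseSemigroup (BruckReilly θ)) ∧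
      ∃ i : ℕ, Topology.IsEmbedding (fun t : T => (⟨i, t, i⟩ : BruckReilly θ))

end BruckReilly

end BruckReilly

end OmegaSemigroup

/-!
Write `e 0 ≻ e 1 ≻ ⋯` for the nonzero idempotents of `S` and `H m n` for the set of the `x` with
`x x⁻¹ = e m` and `x⁻¹ x = e n`; these are the nonzero `ℋ`-classes, and the `H n n` are the maximal
subgroups. Conjugation by `x ∈ H m n` is an isomorphism of `ω`-chains, hence takes `e (m + i)` to
`e (n + i)` (`OmegaFrame.conj_e`). By `0`-simplicity some `H 0 d` with `d > 0` is nonempty. For the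
least such `d` and `p ∈ H 0 d`, the class `H m n` is nonempty only if `m ≡ n` modulo `d`, and every
nonzero element is uniquely `p⁻ⁱ t pʲ` with `t` in `T = H 0 0 ∪ ⋯ ∪ H (d - 1) (d - 1)`. This is an
isomorphism of `BR⁰(T, θ)` onto `S` for `θ t = p t p⁻¹` (`BruckReillyFrame.equiv`).

For the topology, all classes `H m n` are translates of maximal subgroups, so they are compact, and
as all but finitely many of them are removed from `S` by the open conditions `e (m + 1) x ≠ x` and
`x e (n + 1) ≠ x`, they are also open (`OmegaFrame.isOpen_H`). This gives the sum direct topology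
away from `0`. Only separate continuity is assumed, so that joint continuity in `BR(T, θ)` rests on
Ellis' theorem that compact semitopological groups are topological groups
(`isTopologicalGroup_of_compact`). It is proved here by a weak form of Namioka's theorem for
separable groups, to which the general case is reduced by a choice of sequences.

If `S` is locally compact and `0` is not isolated, a compact neighbourhood of `0` contains all but
finitely many of the `ℋ`-classes (`BruckReillyFrame.compactSpace_of_not_isOpen_zero`), so `S` is
compact; if `0` is isolated, all `ℋ`-classes are open and compact.
-/

namespace OmegaSemigroup

open Topology Filter Set

/-! ### Compact semitopological groups -/

section Ellis

/-- A continuous real function on a compact space which is constant on the fibres of a continuous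
surjection onto a Hausdorff space factors through it. -/
theorem exists_continuousMap_factor {K Z : Type*} [TopologicalSpace K] [CompactSpace K]
    [TopologicalSpace Z] [T2Space Z] {π : K → Z} (hπ : Continuous π)
    (hsurj : Function.Surjective π) {f : K → ℝ} (hf : Continuous f)
    (h : ∀ a b, π a = π b → f a = f b) : ∃ g : C(Z, ℝ), ∀ a, g (π a) = f a := by
  have hq : IsQuotientMap (⟨π, hπ⟩ : C(K, Z)) := hπ.isClosedMap.isQuotientMap hπ hsurj
  exact ⟨hq.lift ⟨f, hf⟩ fun a b hab => h a b hab,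
    fun a => DFunLike.congr_fun (hq.lift_comp ⟨f, hf⟩ fun a b hab => h a b hab) a⟩

/-- A separately continuous function of two compact variables, the second one separable, is
determined in the second variable by countably many values of the first. -/
theorem exists_seq_separating {X Y : Type*} [TopologicalSpace X] [CompactSpace X] [Nonempty X]
    [TopologicalSpace Y] [TopologicalSpace.SeparableSpace Y] {F : X → Y → ℝ}
    (h₁ : ∀ y, Continuous fun x => F x y) (h₂ : ∀ x, Continuous (F x)) :
    ∃ c : ℕ → X, ∀ y y', (∀ n, F (c n) y = F (c n) y') → ∀ x, F x y = F x y' := by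
  obtain ⟨D, hDc, hD⟩ := TopologicalSpace.exists_countable_dense Y
  have := hDc.to_subtype
  let ev : X → D → ℝ := fun x d => F x d
  have hev : Continuous ev := continuous_pi fun d => h₁ d
  let π : X → range ev := rangeFactorization ev
  have hπ : Continuous π := hev.subtype_mk _
  have hsurj : Function.Surjective π := rangeFactorization_surjective
  have hfac (y : Y) : ∃ g : C(range ev, ℝ), ∀ x, g (π x) = F x y := by
    refine exists_continuousMap_factor hπ hsurj (h₁ y) fun a b hab => ?_
    have hab' : ev a = ev b := congrArg Subtype.val hab
    have : EqOn (F a) (F b) D := fun d hd => congrFun hab' ⟨d, hd⟩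
    exact congrFun ((h₂ a).ext_on hD (h₂ b) this) y
  have : Nonempty (range ev) := ⟨π (Classical.arbitrary X)⟩
  choose g hg using hfac
  choose c hc using fun n => hsurj (TopologicalSpace.denseSeq (range ev) n)
  refine ⟨c, fun y y' h x => ?_⟩
  have : EqOn (g y) (g y') (range (TopologicalSpace.denseSeq (range ev))) := by
    rintro _ ⟨n, rfl⟩
    rw [← hc n, hg, hg, h n]
  have := (g y).continuous.ext_on (TopologicalSpace.denseRange_denseSeq _) (g y').continuous this
  rw [← hg, ← hg, this]

/-- A weak form of Namioka's theorem. The values of `F` on countably many `c n : X` give a compact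
metrizable quotient of `Y` through which all `F x` factor, so that the functions `F x` lie in a
separable space of continuous functions, and the Baire property of `X` applies. -/
theorem exists_isOpen_uniform_small {X Y : Type*} [TopologicalSpace X] [CompactSpace X]
    [T2Space X] [Nonempty X] [TopologicalSpace Y] [CompactSpace Y]
    [TopologicalSpace.SeparableSpace Y] {F : X → Y → ℝ}
    (h₁ : ∀ y, Continuous fun x => F x y) (h₂ : ∀ x, Continuous (F x)) {ε : ℝ} (hε : 0 < ε) :
    ∃ V : Set X, IsOpen V ∧ V.Nonempty ∧ ∀ x ∈ V, ∀ x' ∈ V, ∀ y, |F x y - F x' y| ≤ ε := by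
  obtain ⟨c, hc⟩ := exists_seq_separating h₁ h₂
  let ev : Y → ℕ → ℝ := fun y n => F (c n) y
  have hev : Continuous ev := continuous_pi fun n => h₂ (c n)
  let π : Y → range ev := rangeFactorization ev
  have hπ : Continuous π := hev.subtype_mk _
  have hsurj : Function.Surjective π := rangeFactorization_surjective
  have : CompactSpace (range ev) := isCompact_iff_compactSpace.1 (isCompact_range hev)
  have hfac (x : X) : ∃ g : C(range ev, ℝ), ∀ y, g (π y) = F x y := by
    refine exists_continuousMap_factor hπ hsurj (h₂ x) fun a b hab => ?_
    have hab' : ev a = ev b := congrArg Subtype.val hab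
    exact hc a b (fun n => congrFun hab' n) x
  choose g hg using hfac
  let s := TopologicalSpace.denseSeq C(range ev, ℝ)
  let A : ℕ → Set X := fun n => {x | ∀ y, |F x y - s n (π y)| ≤ ε / 2}
  have hA (n : ℕ) : IsClosed (A n) := by
    simp only [A, ofPred_forall]
    exact isClosed_iInter fun y => isClosed_le ((h₁ y).sub continuous_const).abs continuous_const
  have hcover : ⋃ n, A n = univ := by
    refine eq_univ_of_forall fun x => mem_iUnion.2 ?_
    obtain ⟨n, hn⟩ := (TopologicalSpace.denseRange_denseSeq C(range ev, ℝ)).exists_dist_lt (g x)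
      (half_pos hε)
    refine ⟨n, fun y => ?_⟩
    rw [← hg, ← Real.dist_eq]
    exact (ContinuousMap.dist_apply_le_dist (π y)).trans hn.le
  obtain ⟨n, hn⟩ := nonempty_interior_of_iUnion_of_closed hA hcover
  refine ⟨interior (A n), isOpen_interior, hn, fun x hx x' hx' y => ?_⟩
  have h := interior_subset hx y
  have h' := interior_subset hx' y
  rw [abs_le] at h h' ⊢
  constructor <;> linarith [h.1, h.2, h'.1, h'.2]

variable {G : Type*} [Group G] [TopologicalSpace G] [SeparatelyContinuousMul G]
  [CompactSpace G] [T2Space G]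

/-- Right translations preserve uniform distances, so that the smallness of the oscillation on some
open set carries over to a neighbourhood of any point. -/
theorem eventually_uniform_of_separable [TopologicalSpace.SeparableSpace G] {f : G → ℝ}
    (hf : Continuous f) (x : G) {ε : ℝ} (hε : 0 < ε) :
    ∀ᶠ x' in 𝓝 x, ∀ y, |f (x' * y) - f (x * y)| ≤ ε := by
  obtain ⟨V, hV, ⟨g, hg⟩, h⟩ := exists_isOpen_uniform_small (F := fun x y : G => f (x * y))
    (fun y => hf.comp (continuous_mul_const y)) (fun x => hf.comp (continuous_const_mul x)) hε
  have hcont : Continuous fun x' : G => x' * (x⁻¹ * g) := continuous_mul_const _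
  filter_upwards [hcont.continuousAt.preimage_mem_nhds (hV.mem_nhds (by simpa using hg))]
    with x' hx' y
  simpa [mul_assoc] using h _ hx' g hg (g⁻¹ * x * y)

/-- In a compact Hausdorff semitopological group, the closure of a subgroup is a subgroup: a
compact subsemigroup contains an idempotent, which can only be `1`. -/
theorem exists_subgroup_closure (D : Subgroup G) :
    ∃ H : Subgroup G, (H : Set G) = closure (D : Set G) := by
  have hmul : ∀ a ∈ closure (D : Set G), ∀ b ∈ closure (D : Set G),
      a * b ∈ closure (D : Set G) := by
    have h₁ : ∀ a ∈ D, ∀ b ∈ closure (D : Set G), a * b ∈ closure (D : Set G) := fun a ha b hb =>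
      map_mem_closure (continuous_const_mul a) hb fun c hc => D.mul_mem ha hc
    intro a ha b hb
    have := map_mem_closure (continuous_mul_const b) ha (t := closure (D : Set G))
      fun c hc => h₁ c hc b hb
    rwa [closure_closure] at this
  have hone : (1 : G) ∈ closure (D : Set G) := subset_closure D.one_mem
  refine ⟨{ carrier := closure (D : Set G), mul_mem' := fun ha hb => hmul _ ha _ hb,
            one_mem' := hone, inv_mem' := fun {x} hx => ?_ }, rfl⟩
  obtain ⟨m, ⟨a, ha, rfl⟩, hm⟩ := exists_idempotent_in_compact_subsemigroup
    (M := G) (fun r => continuous_mul_const r) ((x * ·) '' closure (D : Set G))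
    ⟨_, 1, hone, rfl⟩ (isClosed_closure.isCompact.image (continuous_const_mul x)) (by
      rintro _ ⟨a, ha, rfl⟩ _ ⟨b, hb, rfl⟩
      exact ⟨a * (x * b), hmul _ ha _ (hmul _ hx _ hb), by simp [mul_assoc]⟩)
  have : x * a = 1 := by simpa using hm
  rwa [inv_eq_of_mul_eq_one_right this]

/-- Translation is continuous for the uniform norm. A failure would be witnessed by
sequences `xₙ`, `yₙ`, chosen so that every cluster point `x` of `xₙ` almost fixes all
`f (yₙ)`; the closed subgroup which they generate is separable. -/
theorem eventually_uniform_one {f : G → ℝ} (hf : Continuous f) {ε : ℝ} (hε : 0 < ε) :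
    ∀ᶠ x in 𝓝 (1 : G), ∀ y, |f (x * y) - f y| ≤ ε := by
  by_contra hcon
  have hfreq : ∃ᶠ x in 𝓝 (1 : G), ∃ y, ε < |f (x * y) - f y| := by
    rw [not_eventually] at hcon
    exact hcon.mono fun x hx => by simpa only [not_forall, not_le] using hx
  obtain ⟨u, hu, hur⟩ := exists_seq_of_forall_finset_exists
    (fun z : G × G => ε < |f (z.1 * z.2) - f z.2|)
    (fun z w : G × G => |f (w.1 * z.2) - f z.2| ≤ ε / 2) (by
      intro s _
      have hnhds : ∀ᶠ x in 𝓝 (1 : G), ∀ z ∈ s, |f (x * z.2) - f z.2| < ε / 2 := by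
        rw [Filter.eventually_all_finset]
        intro z _
        have hc : Continuous fun x : G => |f (x * z.2) - f z.2| :=
          ((hf.comp (continuous_mul_const z.2)).sub continuous_const).abs
        refine hc.continuousAt.eventually (gt_mem_nhds ?_)
        simpa using half_pos hε
      obtain ⟨x, ⟨y, hy⟩, hx⟩ := (hfreq.and_eventually hnhds).exists
      exact ⟨(x, y), hy, fun z hz => (hx z hz).le⟩)
  let A : Set G := range (fun n => (u n).1) ∪ range (fun n => (u n).2)
  have hAc : A.Countable := (countable_range _).union (countable_range _)
  obtain ⟨H, hH⟩ := exists_subgroup_closure (Subgroup.closure A)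
  have hsub : (Subgroup.closure A : Set G) ⊆ H := hH ▸ subset_closure
  have hx (n : ℕ) : (u n).1 ∈ H := hsub (Subgroup.subset_closure (Or.inl ⟨n, rfl⟩))
  have hy (n : ℕ) : (u n).2 ∈ H := hsub (Subgroup.subset_closure (Or.inr ⟨n, rfl⟩))
  have hHcl : IsClosed (H : Set G) := hH ▸ isClosed_closure
  have : CompactSpace H := isCompact_iff_compactSpace.1 hHcl.isCompact
  have : TopologicalSpace.SeparableSpace H := by
    have := hAc.to_subtype
    have hDc : (Subgroup.closure A : Set G).Countable := by
      rw [← Subtype.range_coe (s := A), ← FreeGroup.range_lift_eq_closure, MonoidHom.coe_range]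
      exact countable_range _
    refine ⟨((↑) : H → G) ⁻¹' (Subgroup.closure A : Set G),
      hDc.preimage Subtype.val_injective, ?_⟩
    rw [Subtype.dense_iff]
    intro x hxH
    have himg := Subtype.image_preimage_coe (H : Set G) (Subgroup.closure A : Set G)
    rw [inter_eq_right.2 hsub] at himg
    exact (himg.symm ▸ hH ▸ hxH : x ∈ closure (Subtype.val '' _))
  have : SeparatelyContinuousMul H :=
    ⟨fun {a} => ((continuous_const_mul (a : G)).comp continuous_subtype_val).subtype_mk _,
     fun {a} => ((continuous_mul_const (a : G)).comp continuous_subtype_val).subtype_mk _⟩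
  obtain ⟨x, hxc⟩ := exists_clusterPt_of_compactSpace (map (fun n => (⟨_, hx n⟩ : H)) atTop)
  have hfix (i : ℕ) : |f (x * (u i).2) - f (u i).2| ≤ ε / 2 := by
    have hcl : IsClosed {z : H | |f (z * (u i).2) - f (u i).2| ≤ ε / 2} :=
      isClosed_le (((hf.comp (continuous_mul_const _)).comp continuous_subtype_val).sub
        continuous_const).abs continuous_const
    refine hcl.closure_subset (mem_closure_iff_clusterPt.2 (hxc.mono ?_))
    rw [le_principal_iff, mem_map]
    filter_upwards [eventually_gt_atTop i] with n hn using hur i n hn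
  have hev := eventually_uniform_of_separable (hf.comp (continuous_subtype_val (p := (· ∈ H)))) x
    (by positivity : 0 < ε / 4)
  obtain ⟨n, hn⟩ := (mapClusterPt_iff_frequently.1 hxc _ hev).exists
  have h₁ : |f ((u n).1 * (u n).2) - f (x * (u n).2)| ≤ ε / 4 := hn ⟨_, hy n⟩
  have h₂ := hfix n
  have h₃ : ε < |f ((u n).1 * (u n).2) - f (u n).2| := hu n
  have := abs_sub_le (f ((u n).1 * (u n).2)) (f (x * (u n).2)) (f (u n).2)
  linarith

/-- **Ellis' theorem**, for compact groups: a compact Hausdorff group with separately continuous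
multiplication is a topological group. -/
theorem isTopologicalGroup_of_compact : IsTopologicalGroup G := by
  have hmul : ContinuousMul G := by
    refine ⟨continuous_iff_continuousAt.2 fun ⟨x₀, y₀⟩ => ?_⟩
    intro U hU
    obtain ⟨W, hWU, hW, hmem⟩ := mem_nhds_iff.1 hU
    obtain ⟨f, hf0, hf1, -⟩ := exists_continuous_zero_one_of_isClosed
      (isClosed_singleton (x := x₀ * y₀)) hW.isClosed_compl
      (by simpa using hmem)
    have hshift : ∀ᶠ x in 𝓝 x₀, ∀ y, |f (x * y) - f (x₀ * y)| ≤ 1 / 4 := by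
      have hc : Continuous fun x : G => x * x₀⁻¹ := continuous_mul_const _
      have ht : Tendsto (fun x : G => x * x₀⁻¹) (𝓝 x₀) (𝓝 1) := by
        simpa using hc.tendsto x₀
      filter_upwards [ht.eventually (eventually_uniform_one f.continuous
        (by norm_num : (0 : ℝ) < 1 / 4))] with x hx y
      simpa [mul_assoc] using hx (x₀ * y)
    have hy : ∀ᶠ y in 𝓝 y₀, |f (x₀ * y)| < 1 / 4 := by
      have hc : Continuous fun y : G => |f (x₀ * y)| :=
        (f.continuous.comp (continuous_const_mul x₀)).abs
      refine hc.continuousAt.eventually (gt_mem_nhds ?_)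
      have : f (x₀ * y₀) = 0 := hf0 rfl
      simp [this]
    rw [mem_map, nhds_prod_eq]
    filter_upwards [hshift.prod_mk hy] with z hz
    refine hWU (by_contra fun hzW => ?_)
    have h₁ : f (z.1 * z.2) = 1 := hf1 hzW
    have h₂ := hz.1 z.2
    have h₃ := hz.2
    rw [h₁] at h₂
    rw [abs_le] at h₂
    rw [abs_lt] at h₃
    linarith [h₂.2, h₃.2]
  refine { hmul with continuous_inv := ?_ }
  rw [continuous_iff_isClosed]
  intro C hC
  -- the inverse image of `C` is a projection of a closed subset of the compact space `G × G`
  have : (fun x : G => x⁻¹) ⁻¹' C = Prod.fst '' {z : G × G | z.1 * z.2 = 1 ∧ z.2 ∈ C} := by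
    ext x
    constructor
    · exact fun hx => ⟨(x, x⁻¹), ⟨by simp, hx⟩, rfl⟩
    · rintro ⟨⟨a, b⟩, ⟨hab, hb⟩, rfl⟩
      simpa [inv_eq_of_mul_eq_one_right hab] using hb
  rw [this]
  exact isClosedMap_fst_of_compactSpace _
    ((isClosed_eq continuous_mul continuous_const).inter (hC.preimage continuous_snd))

end Ellis

/-! ### The chain of idempotents and the `ℋ`-classes -/

section OmegaFrame

/-- An inversion and an enumeration `e 0 ≻ e 1 ≻ ⋯` of the nonzero idempotents of an inverse
semigroup with zero whose nonzero idempotents form an `ω`-chain. -/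
structure OmegaFrame (S : Type u) [SemigroupWithZero S] where
  inv : S → S
  e : ℕ → S
  isInverseOf_iff : ∀ x y, IsInverseOf x y ↔ y = inv x
  e_ne_zero : ∀ n, e n ≠ 0
  e_mul_e : ∀ m n, e m * e n = e (max m n)
  e_injective : Function.Injective e
  exists_e : ∀ x, IsIdempotentElem x → x ≠ 0 → ∃ n, x = e n

theorem IsZeroSimpleInverseOmegaSemigroup.nonempty_omegaFrame {S : Type u} [SemigroupWithZero S]
    (hS : IsZeroSimpleInverseOmegaSemigroup S) : Nonempty (OmegaFrame S) := by
  choose inv hinv using hS.inverse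
  obtain ⟨ι⟩ := hS.omega
  have hle (m n : ℕ) (h : n ≤ m) : IdemLE (ι.symm m).1 (ι.symm n).1 :=
    ι.symm.map_rel_iff.2 h
  refine ⟨⟨inv, fun n => (ι.symm n).1, fun x y => ⟨fun h => (hinv x).2 y h, ?_⟩,
    fun n => (ι.symm n).2.2, fun m n => ?_, fun m n h => ι.symm.injective (Subtype.ext h),
    fun x hx h0 =>
      ⟨ι ⟨x, hx, h0⟩, (congrArg Subtype.val (ι.symm_apply_apply ⟨x, hx, h0⟩)).symm⟩⟩⟩
  · rintro rfl
    exact (hinv x).1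
  · rcases le_total m n with h | h
    · rw [max_eq_right h]
      exact (hle n m h).2
    · rw [max_eq_left h]
      exact (hle m n h).1

namespace OmegaFrame

variable {S : Type u} [SemigroupWithZero S] (C : OmegaFrame S)

theorem mul_inv_mul (x : S) : x * C.inv x * x = x := ((C.isInverseOf_iff x _).2 rfl).1

theorem inv_mul_inv (x : S) : C.inv x * x * C.inv x = C.inv x := ((C.isInverseOf_iff x _).2 rfl).2

theorem inv_eq {x y : S} (h : x * y * x = x) (h' : y * x * y = y) : C.inv x = y :=
  ((C.isInverseOf_iff x y).1 ⟨h, h'⟩).symm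

theorem inv_inv (x : S) : C.inv (C.inv x) = x := C.inv_eq (C.inv_mul_inv x) (C.mul_inv_mul x)

theorem isIdempotentElem_mul_inv (x : S) : IsIdempotentElem (x * C.inv x) := by
  rw [IsIdempotentElem, ← mul_assoc, C.mul_inv_mul]

theorem isIdempotentElem_inv_mul (x : S) : IsIdempotentElem (C.inv x * x) := by
  rw [IsIdempotentElem, ← mul_assoc, C.inv_mul_inv]

theorem e_idem (n : ℕ) : C.e n * C.e n = C.e n := by rw [C.e_mul_e, max_self]

/-- The `ℋ`-class of the elements `x` with `x x⁻¹ = e m` and `x⁻¹ x = e n`. -/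
def H (m n : ℕ) : Set S := {x | x * C.inv x = C.e m ∧ C.inv x * x = C.e n}

variable {C} {x y : S} {m n k l : ℕ}

theorem ne_zero_of_mem (hx : x ∈ C.H m n) : x ≠ 0 := by
  rintro rfl
  exact C.e_ne_zero m (by rw [← hx.1, zero_mul])

theorem exists_mem_H (C : OmegaFrame S) (hx : x ≠ 0) : ∃ m n, x ∈ C.H m n := by
  obtain ⟨m, hm⟩ := C.exists_e _ (C.isIdempotentElem_mul_inv x) fun h =>
    hx (by rw [← C.mul_inv_mul x, h, zero_mul])
  obtain ⟨n, hn⟩ := C.exists_e _ (C.isIdempotentElem_inv_mul x) fun h =>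
    hx (by rw [← C.mul_inv_mul x, mul_assoc, h, mul_zero])
  exact ⟨m, n, hm, hn⟩

theorem eq_of_mem_of_mem (hx : x ∈ C.H m n) (hx' : x ∈ C.H k l) : m = k ∧ n = l :=
  ⟨C.e_injective (hx.1.symm.trans hx'.1), C.e_injective (hx.2.symm.trans hx'.2)⟩

theorem inv_mem (hx : x ∈ C.H m n) : C.inv x ∈ C.H n m := by
  rw [H, mem_ofPred_eq, C.inv_inv]
  exact ⟨hx.2, hx.1⟩

theorem e_mem (C : OmegaFrame S) (n : ℕ) : C.e n ∈ C.H n n := by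
  have : C.inv (C.e n) = C.e n := C.inv_eq (by simp [e_idem]) (by simp [e_idem])
  rw [H, mem_ofPred_eq, this, e_idem]
  exact ⟨rfl, rfl⟩

theorem e_mul (hx : x ∈ C.H m n) (h : k ≤ m) : C.e k * x = x := by
  rw [← C.mul_inv_mul x, hx.1, ← mul_assoc, C.e_mul_e, max_eq_right h]

theorem mul_e (hx : x ∈ C.H m n) (h : k ≤ n) : x * C.e k = x := by
  rw [← C.mul_inv_mul x, mul_assoc x, hx.2, mul_assoc, C.e_mul_e, max_eq_left h]

theorem e_mul_iff (hx : x ∈ C.H m n) : C.e k * x = x ↔ k ≤ m := by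
  refine ⟨fun h => ?_, e_mul hx⟩
  have : C.e (max k m) = C.e m := by rw [← C.e_mul_e, ← hx.1, ← mul_assoc, h]
  exact max_eq_right_iff.1 (C.e_injective this)

theorem mul_e_iff (hx : x ∈ C.H m n) : x * C.e k = x ↔ k ≤ n := by
  refine ⟨fun h => ?_, mul_e hx⟩
  have : C.e (max n k) = C.e n := by rw [← C.e_mul_e, ← hx.2, mul_assoc, h]
  exact max_eq_left_iff.1 (C.e_injective this)

theorem mem_H_of (hxy : x * y = C.e m) (hyx : y * x = C.e n) (hx : x * C.e n = x)
    (hy : C.e n * y = y) : x ∈ C.H m n := by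
  have : C.inv x = y := C.inv_eq (by rw [mul_assoc, hyx, hx]) (by rw [hyx, hy])
  exact ⟨this ▸ hxy, this ▸ hyx⟩

theorem mul_mem (hx : x ∈ C.H m n) (hy : y ∈ C.H n k) : x * y ∈ C.H m k := by
  have h₁ : x * y * (C.inv y * C.inv x) = C.e m := by
    rw [mul_assoc, ← mul_assoc y, hy.1, e_mul (inv_mem hx) le_rfl, hx.1]
  have h₂ : C.inv y * C.inv x * (x * y) = C.e k := by
    rw [mul_assoc, ← mul_assoc _ x, hx.2, e_mul hy le_rfl, hy.2]
  refine mem_H_of h₁ h₂ ?_ ?_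
  · rw [mul_assoc, mul_e hy le_rfl]
  · rw [← mul_assoc, e_mul (inv_mem hy) le_rfl]

theorem conj_mul (hx : x ∈ C.H m n) (a b : S) :
    C.inv x * a * x * (C.inv x * b * x) = C.inv x * (a * C.e m * b) * x := by
  rw [← hx.1]
  simp only [mul_assoc]

/-- Conjugation by `x` sends the idempotents below `e m` to idempotents below `e n`. -/
theorem exists_conj (hx : x ∈ C.H m n) (i : ℕ) :
    ∃ j, C.inv x * C.e (m + i) * x = C.e (n + j) := by
  have h₁ : x * (C.inv x * C.e (m + i) * x) * C.inv x = C.e (m + i) := by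
    rw [mul_assoc _ _ x, ← mul_assoc x, hx.1, mul_assoc _ _ (C.inv x), mul_assoc _ x, hx.1,
      C.e_mul_e, C.e_mul_e]
    congr 1
    omega
  obtain ⟨j, hj⟩ := C.exists_e (C.inv x * C.e (m + i) * x) (by
      rw [IsIdempotentElem, conj_mul hx, C.e_mul_e, C.e_mul_e]
      congr 3
      omega) (by
      intro h
      rw [h, mul_zero, zero_mul] at h₁
      exact C.e_ne_zero _ h₁.symm)
  have hle : n ≤ j := by
    have : C.e (max n j) = C.e j := by
      rw [← C.e_mul_e, ← hj, ← mul_assoc, ← mul_assoc, e_mul (inv_mem hx) le_rfl]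
    exact max_eq_right_iff.1 (C.e_injective this)
  exact ⟨j - n, by rw [hj, Nat.add_sub_cancel' hle]⟩

/-- Conjugation by `x ∈ H m n` is an order isomorphism between the principal ideals of `e m` and
`e n` in the `ω`-chain of idempotents; there is only one such isomorphism. -/
theorem conj_e (hx : x ∈ C.H m n) (i : ℕ) : C.inv x * C.e (m + i) * x = C.e (n + i) := by
  choose! f hf using fun (m n : ℕ) (x : S) (h : x ∈ C.H m n) => exists_conj h
  have hmono (m n : ℕ) (x : S) (h : x ∈ C.H m n) : StrictMono (f m n x) := by
    have hcancel (i : ℕ) : x * C.e (n + f m n x i) * C.inv x = C.e (m + i) := by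
      rw [← hf m n x h i, mul_assoc _ _ x, ← mul_assoc x, h.1, mul_assoc _ _ (C.inv x),
        mul_assoc _ x, h.1, C.e_mul_e, C.e_mul_e]
      congr 1
      omega
    refine Monotone.strictMono_of_injective (fun i j hij => ?_) fun i j hij => ?_
    · have : C.e (max (n + f m n x i) (n + f m n x j)) = C.e (n + f m n x j) := by
        rw [← C.e_mul_e, ← hf m n x h i, ← hf m n x h j, conj_mul h, C.e_mul_e,
          C.e_mul_e]
        congr 3
        omega
      have := C.e_injective this
      omega
    · have h₁ := hcancel i
      rw [hij, hcancel j] at h₁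
      have := C.e_injective h₁
      omega
  have hgf : f n m (C.inv x) (f m n x i) = i := by
    have := hf n m _ (inv_mem hx) (f m n x i)
    rw [← hf m n x hx i, C.inv_inv, mul_assoc _ _ x, ← mul_assoc x, hx.1, mul_assoc _ _ (C.inv x),
      mul_assoc _ x, hx.1, C.e_mul_e, C.e_mul_e] at this
    have := C.e_injective this
    omega
  have h₁ := (hmono m n x hx).le_apply (x := i)
  have h₂ := (hmono n m _ (inv_mem hx)).le_apply (x := f m n x i)
  rw [hf m n x hx i]
  congr 2
  omega

theorem e_add_mul (hx : x ∈ C.H m n) (i : ℕ) : C.e (m + i) * x = x * C.e (n + i) := by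
  rw [← conj_e hx i, ← mul_assoc, ← mul_assoc, hx.1, C.e_mul_e, max_eq_right (Nat.le_add_right _ _)]

theorem e_add_mul_mem (hx : x ∈ C.H m n) (i : ℕ) : C.e (m + i) * x ∈ C.H (m + i) (n + i) := by
  have h₁ : C.e (m + i) * x * (C.inv x * C.e (m + i)) = C.e (m + i) := by
    rw [mul_assoc, ← mul_assoc x, hx.1, C.e_mul_e, C.e_mul_e]
    congr 1
    omega
  have h₂ : C.inv x * C.e (m + i) * (C.e (m + i) * x) = C.e (n + i) := by
    rw [mul_assoc, ← mul_assoc (C.e _), e_idem, ← mul_assoc, conj_e hx]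
  refine mem_H_of h₁ h₂ ?_ ?_
  · rw [e_add_mul hx, mul_assoc, e_idem]
  · rw [← e_add_mul (inv_mem hx), ← mul_assoc, e_idem]

theorem e_mul_comm (hx : x ∈ C.H m m) (h : m ≤ k) : C.e k * x = x * C.e k := by
  obtain ⟨i, rfl⟩ := Nat.exists_eq_add_of_le h
  exact e_add_mul hx i

theorem e_mul_mem (hx : x ∈ C.H m m) (h : m ≤ k) : C.e k * x ∈ C.H k k := by
  obtain ⟨i, rfl⟩ := Nat.exists_eq_add_of_le h
  exact e_add_mul_mem hx i

theorem H_zero_nonempty_of_zeroSimple (C : OmegaFrame S) (hS : IsZeroSimple S) :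
    ∃ d, 0 < d ∧ (C.H 0 d).Nonempty := by
  have hI : {z : S | ∃ a b, z = a * C.e 1 * b} = univ := by
    by_contra hne
    have := (hS {z | ∃ a b, z = a * C.e 1 * b} ⟨⟨_, C.e 1, C.e 1, rfl⟩, ?_⟩).1 hne
    · have h1 : C.e 1 ∈ ({0} : Set S) :=
        this ▸ ⟨C.e 1, C.e 1, by rw [e_idem, e_idem]⟩
      exact C.e_ne_zero 1 h1
    · rintro s _ ⟨a, b, rfl⟩
      exact ⟨⟨s * a, b, by simp only [mul_assoc]⟩, ⟨a, b * s, by simp only [mul_assoc]⟩⟩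
  obtain ⟨a, b, hab⟩ : C.e 0 ∈ {z : S | ∃ a b, z = a * C.e 1 * b} := hI ▸ mem_univ _
  have hz : C.e 0 * a * C.e 1 * b = C.e 0 := by rw [mul_assoc (C.e 0), mul_assoc, ← hab, e_idem]
  obtain ⟨m, n, hmn⟩ := C.exists_mem_H (x := C.e 0 * a * C.e 1) (by
    intro h
    rw [h, zero_mul] at hz
    exact C.e_ne_zero 0 hz.symm)
  have hm : m ≤ 0 := by
    rw [← e_mul_iff (e_mem C 0), ← hz, ← mul_assoc, e_mul hmn le_rfl]
  obtain rfl := Nat.le_zero.1 hm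
  exact ⟨n, (mul_e_iff hmn).1 (by rw [mul_assoc, e_idem]), _, hmn⟩

end OmegaFrame

/-- An `OmegaFrame` with an element `p` such that `p p⁻¹ = e 0` and `p⁻¹ p = e d`, where `d > 0` is
least possible. Together with `p⁻¹`, it generates a bicyclic semigroup. -/
structure BruckReillyFrame (S : Type u) [SemigroupWithZero S] extends OmegaFrame S where
  d : ℕ
  d_pos : 0 < d
  p : S
  p_mem : p ∈ toOmegaFrame.H 0 d
  d_le : ∀ k, 0 < k → (toOmegaFrame.H 0 k).Nonempty → d ≤ k

theorem IsZeroSimpleInverseOmegaSemigroup.nonempty_bruckReillyFrame {S : Type u}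
    [SemigroupWithZero S] (hS : IsZeroSimpleInverseOmegaSemigroup S) :
    Nonempty (BruckReillyFrame S) := by
  classical
  obtain ⟨C⟩ := hS.nonempty_omegaFrame
  have h := C.H_zero_nonempty_of_zeroSimple hS.zeroSimple
  obtain ⟨hpos, p, hp⟩ := Nat.find_spec h
  exact ⟨{ C with d := Nat.find h, d_pos := hpos, p := p, p_mem := hp,
                  d_le := fun k hk hk' => Nat.find_min' h ⟨hk, hk'⟩ }⟩

namespace BruckReillyFrame

open OmegaFrame

variable {S : Type u} [SemigroupWithZero S] (B : BruckReillyFrame S)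

/-- The powers `pⁱ`, with `p⁰ = e 0` the identity of the semigroup. -/
def pPow : ℕ → S
  | 0 => B.e 0
  | i + 1 => pPow i * B.p

/-- The powers `p⁻ⁱ`. -/
def qPow (i : ℕ) : S := B.inv (B.pPow i)

theorem e_zero_mul (x : S) : B.e 0 * x = x := by
  by_cases h : x = 0
  · rw [h, mul_zero]
  · obtain ⟨m, n, hx⟩ := B.exists_mem_H h
    exact e_mul hx (Nat.zero_le _)

theorem mul_e_zero (x : S) : x * B.e 0 = x := by
  by_cases h : x = 0
  · rw [h, zero_mul]
  · obtain ⟨m, n, hx⟩ := B.exists_mem_H h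
    exact mul_e hx (Nat.zero_le _)

theorem pPow_mem (i : ℕ) : B.pPow i ∈ B.H 0 (i * B.d) := by
  induction i with
  | zero => simpa [pPow] using e_mem B.toOmegaFrame 0
  | succ i ih =>
    have h : B.e (i * B.d) * B.p ∈ B.H (i * B.d) ((i + 1) * B.d) := by
      have := e_add_mul_mem B.p_mem (i * B.d)
      rwa [Nat.zero_add, Nat.add_comm, ← Nat.succ_mul] at this
    have := mul_mem ih h
    rwa [← mul_assoc, mul_e ih le_rfl] at this

theorem qPow_mem (i : ℕ) : B.qPow i ∈ B.H (i * B.d) 0 := inv_mem (B.pPow_mem i)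

theorem pPow_mul_qPow (i : ℕ) : B.pPow i * B.qPow i = B.e 0 := (B.pPow_mem i).1

theorem qPow_mul_pPow (i : ℕ) : B.qPow i * B.pPow i = B.e (i * B.d) := (B.pPow_mem i).2

theorem pPow_add (i j : ℕ) : B.pPow (i + j) = B.pPow i * B.pPow j := by
  induction j with
  | zero => simp only [pPow, Nat.add_zero, mul_e_zero]
  | succ j ih => rw [← Nat.add_assoc, pPow, pPow, ih, mul_assoc]

theorem qPow_zero : B.qPow 0 = B.e 0 := by
  have := B.qPow_mul_pPow 0
  rwa [Nat.zero_mul, pPow, mul_e_zero] at this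

theorem qPow_add (i j : ℕ) : B.qPow (i + j) = B.qPow j * B.qPow i := by
  have hij := B.pPow_add i j
  refine B.inv_eq ?_ ?_
  · rw [hij, mul_assoc (B.pPow i), ← mul_assoc (B.pPow j), pPow_mul_qPow, e_zero_mul, pPow_mul_qPow,
      e_zero_mul]
  · rw [hij, mul_assoc (_ * _), mul_assoc (B.pPow i), ← mul_assoc (B.pPow j), pPow_mul_qPow,
      e_zero_mul, pPow_mul_qPow, mul_e_zero]

theorem H_add_nonempty {m n : ℕ} (h : (B.H m n).Nonempty) (i : ℕ) :
    (B.H (m + i) (n + i)).Nonempty := by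
  obtain ⟨x, hx⟩ := h
  exact ⟨_, e_add_mul_mem hx i⟩

/-- The class `H m n` is nonempty only if `m ≡ n` modulo `d`, by minimality of `d`. -/
theorem modEq_of_nonempty {m n : ℕ} (h : (B.H m n).Nonempty) : m % B.d = n % B.d := by
  -- every index is `𝒟`-related to its residue
  have hred (k : ℕ) : (B.H (k % B.d) k).Nonempty := by
    have := e_add_mul_mem (B.pPow_mem (k / B.d)) (k % B.d)
    rw [Nat.zero_add, Nat.div_add_mod'] at this
    exact ⟨_, this⟩
  have hres (m n : ℕ) (hmn : m < n) (hn : n < B.d) (h : (B.H m n).Nonempty) : False := by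
    obtain ⟨x, hx⟩ := B.H_add_nonempty h (B.d - n)
    rw [Nat.add_sub_cancel' hn.le] at hx
    have := B.d_le (m + (B.d - n)) (by omega) ⟨_, inv_mem (mul_mem hx (inv_mem B.p_mem))⟩
    omega
  obtain ⟨x, hx⟩ := h
  obtain ⟨a, ha⟩ := hred m
  obtain ⟨b, hb⟩ := hred n
  have hx' := mul_mem (mul_mem ha hx) (inv_mem hb)
  rcases lt_trichotomy (m % B.d) (n % B.d) with h | h | h
  · exact (hres _ _ h (Nat.mod_lt _ B.d_pos) ⟨_, hx'⟩).elim
  · exact h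
  · exact (hres _ _ h (Nat.mod_lt _ B.d_pos) ⟨_, inv_mem hx'⟩).elim

theorem qPow_mul_mul_pPow_mem {r : ℕ} {t : S} (ht : t ∈ B.H r r) (i j : ℕ) :
    B.qPow i * t * B.pPow j ∈ B.H (i * B.d + r) (j * B.d + r) := by
  have h₁ : B.qPow i * B.e r ∈ B.H (i * B.d + r) r := by
    have := e_add_mul_mem (B.qPow_mem i) r
    rwa [e_add_mul (B.qPow_mem i), Nat.zero_add] at this
  have h₂ : B.e r * B.pPow j ∈ B.H r (j * B.d + r) := by
    simpa using e_add_mul_mem (B.pPow_mem j) r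
  have := mul_mem (mul_mem h₁ ht) h₂
  rwa [mul_assoc (B.qPow i), e_mul ht le_rfl, ← mul_assoc, mul_assoc (B.qPow i), mul_e ht le_rfl]
    at this

theorem pPow_mul_mul_qPow_mem {r i j : ℕ} {x : S} (hx : x ∈ B.H (i * B.d + r) (j * B.d + r)) :
    B.pPow i * x * B.qPow j ∈ B.H r r := by
  have h₁ : B.e r * B.pPow i ∈ B.H r (i * B.d + r) := by
    simpa using e_add_mul_mem (B.pPow_mem i) r
  have h₂ : B.qPow j * B.e r ∈ B.H (j * B.d + r) r := by
    have := e_add_mul_mem (B.qPow_mem j) r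
    rwa [e_add_mul (B.qPow_mem j), Nat.zero_add] at this
  have := mul_mem (mul_mem h₁ hx) h₂
  have h₃ := e_add_mul (B.pPow_mem i) r
  have h₄ := e_add_mul (B.qPow_mem j) r
  rw [Nat.zero_add] at h₃ h₄
  rwa [h₃, ← h₄, mul_assoc (B.pPow i), e_mul hx le_rfl, ← mul_assoc, mul_assoc (B.pPow i),
    mul_e hx le_rfl] at this

theorem qPow_pPow_cancel {r i j : ℕ} {x : S} (hx : x ∈ B.H (i * B.d + r) (j * B.d + r)) :
    B.qPow i * (B.pPow i * x * B.qPow j) * B.pPow j = x := by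
  rw [mul_assoc _ _ (B.pPow j), mul_assoc _ (B.qPow j), qPow_mul_pPow, mul_assoc (B.pPow i),
    mul_e hx (Nat.le_add_right _ _), ← mul_assoc, qPow_mul_pPow, e_mul hx (Nat.le_add_right _ _)]

theorem pPow_qPow_cancel (i j : ℕ) (t : S) :
    B.pPow i * (B.qPow i * t * B.pPow j) * B.qPow j = t := by
  rw [mul_assoc _ _ (B.qPow j), mul_assoc _ (B.pPow j), pPow_mul_qPow, mul_e_zero, ← mul_assoc,
    pPow_mul_qPow, e_zero_mul]

/-- Every nonzero element is `p⁻ⁱ t pʲ` for some `t` in one of the groups `H r r`, `r < d`. -/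
theorem exists_coordinates {x : S} (hx : x ≠ 0) :
    ∃ i j r, r < B.d ∧ x ∈ B.H (i * B.d + r) (j * B.d + r) := by
  obtain ⟨m, n, h⟩ := B.exists_mem_H hx
  have hmod := B.modEq_of_nonempty ⟨x, h⟩
  refine ⟨m / B.d, n / B.d, m % B.d, Nat.mod_lt _ B.d_pos, ?_⟩
  rw [Nat.div_add_mod']
  rwa [hmod, Nat.div_add_mod']

theorem eq_of_index_eq {i j r s : ℕ} (hr : r < B.d) (hs : s < B.d)
    (h : i * B.d + r = j * B.d + s) : i = j ∧ r = s := by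
  have h₁ := congrArg (· / B.d) h
  have h₂ := congrArg (· % B.d) h
  simp only [mul_comm _ B.d, Nat.mul_add_div B.d_pos, Nat.div_eq_of_lt hr, Nat.div_eq_of_lt hs,
    Nat.mul_add_mod, Nat.mod_eq_of_lt hr, Nat.mod_eq_of_lt hs, Nat.add_zero] at h₁ h₂
  exact ⟨h₁, h₂⟩

end BruckReillyFrame

end OmegaFrame

/-! ### Units of a strong semilattice of groups -/

section SemilatticeOfGroups

namespace StrongSemilattice

variable {E : Type v} [SemilatticeInf E] [OrderTop E] {G : E → Type u} [∀ α, Group (G α)]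

/-- The group of the greatest index embeds in the strong semilattice. -/
def ofTop (φ : ConnectingHoms E G) : G ⊤ →* StrongSemilattice φ where
  toFun x := ⟨⊤, x⟩
  map_one' := rfl
  map_mul' x y := by
    refine ext' (inf_idem (⊤ : E)).symm ?_
    change φ.map _ (x * y) = φ.map _ x * φ.map _ y
    rw [map_mul]

/-- The elements of the group of the greatest index, as units of the strong semilattice. -/
def unitsOfTop (φ : ConnectingHoms E G) : G ⊤ →* (StrongSemilattice φ)ˣ :=
  (Units.map (ofTop φ)).comp (toUnits (G := G ⊤)).toMonoidHom

end StrongSemilattice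

end SemilatticeOfGroups

/-! ### Isomorphism with a Bruck--Reilly extension -/

section Coordinates

namespace OmegaFrame

variable {S : Type u} [SemigroupWithZero S] (C : OmegaFrame S)

/-- The maximal subgroup with identity `e n`. -/
abbrev MaxGroup (n : ℕ) : Type u := C.H n n

instance (n : ℕ) : Group (C.MaxGroup n) where
  mul x y := ⟨x * y, mul_mem x.2 y.2⟩
  one := ⟨C.e n, e_mem C n⟩
  inv x := ⟨C.inv x, inv_mem x.2⟩
  mul_assoc x y z := Subtype.ext (mul_assoc (x : S) y z)
  one_mul x := Subtype.ext (e_mul x.2 le_rfl)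
  mul_one x := Subtype.ext (mul_e x.2 le_rfl)
  inv_mul_cancel x := Subtype.ext x.2.2

variable {C}

theorem MaxGroup.coe_mul {n : ℕ} (x y : C.MaxGroup n) : ((x * y : C.MaxGroup n) : S) = x * y := rfl

end OmegaFrame

namespace BruckReillyFrame

open OmegaFrame

variable {S : Type u} [SemigroupWithZero S] (B : BruckReillyFrame S)

instance : NeZero B.d := ⟨B.d_pos.ne'⟩

/-- The finite chain indexing the maximal subgroups with identities `e 0 ≻ ⋯ ≻ e (d - 1)`. -/
abbrev Index : Type := (Fin B.d)ᵒᵈ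

/-- The number `r < d` of the idempotent `e r` belonging to an index. -/
abbrev num (α : B.Index) : ℕ := (OrderDual.ofDual α : Fin B.d)

theorem num_top : B.num ⊤ = 0 := Nat.zero_mod _

theorem num_le {α β : B.Index} (h : β ≤ α) : B.num α ≤ B.num β := h

theorem num_injective {α β : B.Index} (h : B.num α = B.num β) : α = β :=
  congrArg OrderDual.toDual (Fin.ext h : OrderDual.ofDual α = OrderDual.ofDual β)

/-- The connecting homomorphisms `x ↦ e β * x` of the maximal subgroups. -/
def connecting : ConnectingHoms B.Index fun α => B.MaxGroup (B.num α) where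
  map {α β} h := MonoidHom.mk' (fun x => ⟨B.e (B.num β) * x, e_mul_mem x.2 (B.num_le h)⟩)
    fun x y => Subtype.ext <| by
      simp only [MaxGroup.coe_mul]
      rw [mul_assoc, ← mul_assoc (x : S), ← e_mul_comm x.2 (B.num_le h), ← mul_assoc,
        ← mul_assoc, ← mul_assoc, e_idem]
  map_self α x := Subtype.ext (e_mul x.2 le_rfl)
  map_map {α β γ} h k x := Subtype.ext <| by
    change B.e (B.num γ) * (B.e (B.num β) * x) = B.e (B.num γ) * x
    rw [← mul_assoc, B.e_mul_e, max_eq_left (B.num_le k)]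

/-- The union of the maximal subgroups with identities `e 0, …, e (d - 1)`, as a strong semilattice
of groups. -/
abbrev Base : Type u := StrongSemilattice B.connecting

variable {B}

/-- The inclusion of `Base` in the semigroup. -/
def val (t : B.Base) : S := t.2

theorem val_mem (t : B.Base) : val t ∈ B.H (B.num t.1) (B.num t.1) := t.2.2

theorem num_lt (t : B.Base) : B.num t.1 < B.d := (OrderDual.ofDual t.1).2

theorem val_injective : Function.Injective (val (B := B)) := by
  rintro ⟨α, x⟩ ⟨β, y⟩ h
  obtain rfl : α = β := B.num_injective (eq_of_mem_of_mem x.2 ((show (x : S) = y from h) ▸ y.2)).1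
  exact congrArg (Sigma.mk α) (Subtype.ext h)

theorem val_mul (s t : B.Base) : val (s * t) = val s * val t := by
  change B.e (max (B.num s.1) (B.num t.1)) * val s * (B.e (max (B.num s.1) (B.num t.1)) * val t)
    = val s * val t
  rw [e_mul_comm (val_mem s) (le_max_left _ _), mul_assoc, ← mul_assoc (B.e _), e_idem,
    e_mul_comm (val_mem t) (le_max_right _ _), ← mul_assoc]
  rcases le_total (B.num s.1) (B.num t.1) with h | h
  · rw [max_eq_right h, mul_assoc, mul_e (val_mem t) le_rfl]
  · rw [max_eq_left h, mul_assoc, ← e_mul_comm (val_mem t) h, ← mul_assoc,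
      mul_e (val_mem s) le_rfl]

theorem exists_val_eq {r : ℕ} (hr : r < B.d) {x : S} (hx : x ∈ B.H r r) :
    ∃ t : B.Base, val t = x :=
  ⟨⟨OrderDual.toDual ⟨r, hr⟩, ⟨x, hx⟩⟩, rfl⟩

theorem e_mul_val_comm (n : ℕ) (t : B.Base) :
    B.e (n * B.d) * val t = val t * B.e (n * B.d) := by
  cases n with
  | zero => rw [Nat.zero_mul, e_zero_mul, mul_e_zero]
  | succ n =>
    exact e_mul_comm (val_mem t) ((num_lt t).le.trans (Nat.le_mul_of_pos_left _ (by omega)))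

theorem conj_mem (t : B.Base) : B.pPow 1 * val t * B.qPow 1 ∈ B.H 0 0 := by
  have h : B.e (1 * B.d) * val t ∈ B.H (1 * B.d) (1 * B.d) :=
    e_mul_mem (val_mem t) (by rw [Nat.one_mul]; exact (num_lt t).le)
  have := mul_mem (mul_mem (B.pPow_mem 1) h) (B.qPow_mem 1)
  rwa [← mul_assoc, mul_e (B.pPow_mem 1) le_rfl] at this

theorem conj_mul (n : ℕ) (s t : B.Base) :
    B.pPow n * (val s * val t) * B.qPow n =
      B.pPow n * val s * B.qPow n * (B.pPow n * val t * B.qPow n) := by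
  calc _ = B.pPow n * B.e (n * B.d) * val s * val t * B.qPow n := by
          rw [mul_e (B.pPow_mem n) le_rfl, ← mul_assoc]
    _ = B.pPow n * (B.e (n * B.d) * val s) * val t * B.qPow n := by simp only [mul_assoc]
    _ = _ := by
      rw [e_mul_val_comm, ← qPow_mul_pPow]
      simp only [mul_assoc]

variable (B)

/-- The homomorphism `t ↦ p t p⁻¹` to the group of units. -/
noncomputable def theta : B.Base →* B.Baseˣ :=
  (StrongSemilattice.unitsOfTop B.connecting).comp <| MonoidHom.mk
    ⟨fun t => (⟨B.pPow 1 * val t * B.qPow 1, by rw [num_top]; exact conj_mem t⟩ :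
        B.MaxGroup (B.num ⊤)), by
      have h1 : val (1 : B.Base) = B.e 0 := congrArg B.e B.num_top
      refine Subtype.ext ?_
      change B.pPow 1 * val (1 : B.Base) * B.qPow 1 = B.e (B.num ⊤)
      rw [h1, mul_e_zero, pPow_mul_qPow, num_top]⟩
    fun s t => Subtype.ext <| by
      change B.pPow 1 * val (s * t) * B.qPow 1 = _ * _
      rw [val_mul, conj_mul]

variable {B}

theorem val_theta (t : B.Base) : val (B.theta t : B.Base) = B.pPow 1 * val t * B.qPow 1 := rfl

theorem val_iter (n : ℕ) (t : B.Base) :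
    val (BruckReilly.iter B.theta n t) = B.pPow n * val t * B.qPow n := by
  induction n generalizing t with
  | zero =>
    rw [qPow_zero, mul_e_zero]
    exact (e_zero_mul B _).symm
  | succ n ih =>
    rw [BruckReilly.iter, Function.iterate_succ_apply, ← BruckReilly.iter, ih, val_theta, pPow_add,
      qPow_add]
    simp only [mul_assoc]

theorem val_mul_qPow (n : ℕ) (t : B.Base) :
    val t * B.qPow n = B.qPow n * val (BruckReilly.iter B.theta n t) := by
  rw [val_iter, ← mul_assoc, ← mul_assoc, qPow_mul_pPow, e_mul_val_comm, mul_assoc,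
    e_mul (B.qPow_mem n) le_rfl]

theorem pPow_mul_val (n : ℕ) (t : B.Base) :
    B.pPow n * val t = val (BruckReilly.iter B.theta n t) * B.pPow n := by
  rw [val_iter, mul_assoc, qPow_mul_pPow, mul_assoc, ← e_mul_val_comm, ← mul_assoc,
    mul_e (B.pPow_mem n) le_rfl]

/-- The map `(i, t, j) ↦ p⁻ⁱ t pʲ`. -/
noncomputable def emb (x : BruckReilly B.theta) : S := B.qPow x.fst * val x.mid * B.pPow x.snd

theorem emb_mem (x : BruckReilly B.theta) :
    emb x ∈ B.H (x.fst * B.d + B.num x.mid.1) (x.snd * B.d + B.num x.mid.1) :=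
  B.qPow_mul_mul_pPow_mem (val_mem x.mid) _ _

theorem emb_injective : Function.Injective (emb (B := B)) := by
  intro x y h
  have hxy := eq_of_mem_of_mem (emb_mem x) (h ▸ emb_mem y)
  have h₁ := B.eq_of_index_eq (num_lt _) (num_lt _) hxy.1
  have h₂ := B.eq_of_index_eq (num_lt _) (num_lt _) hxy.2
  refine BruckReilly.ext h₁.1 (val_injective ?_) h₂.1
  rw [← B.pPow_qPow_cancel x.fst x.snd (val x.mid), ← B.pPow_qPow_cancel y.fst y.snd (val y.mid)]
  rw [emb, emb, h₁.1, h₂.1] at h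
  rw [h₁.1, h₂.1, h]

theorem emb_mul (x y : BruckReilly B.theta) : emb (x * y) = emb x * emb y := by
  obtain ⟨i, s, j⟩ := x
  obtain ⟨k, t, l⟩ := y
  simp only [BruckReilly.mul_def, emb, val_mul]
  rcases le_total j k with h | h
  · obtain ⟨n, rfl⟩ := Nat.exists_eq_add_of_le' h
    have h₁ : i + (n + j) - min j (n + j) = n + i := by omega
    have h₂ : n + j - min j (n + j) = n := by omega
    have h₃ : j - min j (n + j) = 0 := by omega
    have h₄ : j + l - min j (n + j) = l := by omega
    have h₅ : B.pPow j * B.qPow (n + j) = B.qPow n := by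
      rw [qPow_add, ← mul_assoc, pPow_mul_qPow, e_zero_mul]
    rw [h₁, h₂, h₃, h₄, qPow_add]
    calc _ = B.qPow i * (B.qPow n * val (BruckReilly.iter B.theta n s)) * val t * B.pPow l := by
            simp only [mul_assoc, BruckReilly.iter, Function.iterate_zero, id]
      _ = B.qPow i * val s * (B.pPow j * B.qPow (n + j)) * val t * B.pPow l := by
            rw [← val_mul_qPow, h₅]
            simp only [mul_assoc]
      _ = _ := by simp only [mul_assoc]
  · obtain ⟨n, rfl⟩ := Nat.exists_eq_add_of_le' h
    have h₁ : i + k - min (n + k) k = i := by omega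
    have h₂ : k - min (n + k) k = 0 := by omega
    have h₃ : n + k - min (n + k) k = n := by omega
    have h₄ : n + k + l - min (n + k) k = n + l := by omega
    have h₅ : B.pPow (n + k) * B.qPow k = B.pPow n := by
      rw [pPow_add, mul_assoc, pPow_mul_qPow, mul_e_zero]
    rw [h₁, h₂, h₃, h₄, pPow_add]
    calc _ = B.qPow i * val s * (val (BruckReilly.iter B.theta n t) * B.pPow n) * B.pPow l := by
            simp only [mul_assoc, BruckReilly.iter, Function.iterate_zero, id]
      _ = B.qPow i * val s * (B.pPow (n + k) * B.qPow k) * val t * B.pPow l := by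
            rw [← pPow_mul_val, h₅]
            simp only [mul_assoc]
      _ = _ := by simp only [mul_assoc]

theorem emb_ne_zero (x : BruckReilly B.theta) : emb x ≠ 0 := ne_zero_of_mem (emb_mem x)

theorem exists_emb_eq {x : S} (hx : x ≠ 0) : ∃ y : BruckReilly B.theta, emb y = x := by
  obtain ⟨i, j, r, hr, h⟩ := B.exists_coordinates hx
  obtain ⟨t, ht⟩ := exists_val_eq hr (B.pPow_mul_mul_qPow_mem h)
  exact ⟨⟨i, t, j⟩, by rw [emb, ht, B.qPow_pPow_cancel h]⟩

variable (B)

/-- The isomorphism of `BR⁰(T, θ)` onto the semigroup. -/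
noncomputable def equiv : WithZero (BruckReilly B.theta) ≃* S :=
  MulEquiv.ofBijective
    (⟨WithZero.recZeroCoe 0 emb, fun x y => by
      induction x <;> induction y
      · simp
      · simp
      · simp
      · rw [← WithZero.coe_mul]
        exact emb_mul _ _⟩ : WithZero (BruckReilly B.theta) →ₙ* S) (by
      constructor
      · intro x y h
        induction x <;> induction y
        · rfl
        · exact (emb_ne_zero _ h.symm).elim
        · exact (emb_ne_zero _ h).elim
        · exact congrArg _ (emb_injective h)
      · intro x
        by_cases hx : x = 0
        · exact ⟨0, hx.symm⟩
        · obtain ⟨y, hy⟩ := exists_emb_eq (B := B) hx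
          exact ⟨y, hy⟩)

variable {B}

theorem isInverseSemigroup (B : BruckReillyFrame S) :
    IsInverseSemigroup (BruckReilly B.theta) := by
  have hiff (x y : BruckReilly B.theta) : IsInverseOf x y ↔ emb y = B.inv (emb x) := by
    rw [← B.isInverseOf_iff, IsInverseOf, IsInverseOf, ← emb_mul, ← emb_mul, ← emb_mul, ← emb_mul,
      emb_injective.eq_iff, emb_injective.eq_iff]
  intro x
  obtain ⟨y, hy⟩ := exists_emb_eq (B := B) (ne_zero_of_mem (inv_mem (emb_mem x)))
  exact ⟨y, (hiff x y).2 hy, fun z hz => emb_injective (((hiff x z).1 hz).trans hy.symm)⟩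

theorem qPow_one_mul_emb (i j : ℕ) (t : B.Base) :
    B.qPow 1 * emb (⟨i, t, j⟩ : BruckReilly B.theta) =
      emb (⟨i + 1, t, j⟩ : BruckReilly B.theta) := by
  simp only [emb, qPow_add, mul_assoc]

theorem pPow_one_mul_emb (i j : ℕ) (t : B.Base) :
    B.pPow 1 * emb (⟨i + 1, t, j⟩ : BruckReilly B.theta) =
      emb (⟨i, t, j⟩ : BruckReilly B.theta) := by
  rw [← qPow_one_mul_emb, ← mul_assoc, pPow_mul_qPow, e_zero_mul]

theorem emb_mul_pPow_one (i j : ℕ) (t : B.Base) :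
    emb (⟨i, t, j⟩ : BruckReilly B.theta) * B.pPow 1 =
      emb (⟨i, t, j + 1⟩ : BruckReilly B.theta) := by
  simp only [emb, pPow_add, mul_assoc]

theorem emb_mul_qPow_one (i j : ℕ) (t : B.Base) :
    emb (⟨i, t, j + 1⟩ : BruckReilly B.theta) * B.qPow 1 =
      emb (⟨i, t, j⟩ : BruckReilly B.theta) := by
  rw [← emb_mul_pPow_one, mul_assoc, pPow_mul_qPow, mul_e_zero]

/-- The elements `p⁻ⁱ t pʲ` with `i, j < N`. -/
def box (B : BruckReillyFrame S) (N : ℕ) : Set S :=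
  ⋃ i ∈ Iio N, ⋃ j ∈ Iio N, range fun t : B.Base => emb (⟨i, t, j⟩ : BruckReilly B.theta)

theorem emb_mem_box {N : ℕ} (x : BruckReilly B.theta) :
    emb x ∈ B.box N ↔ x.fst < N ∧ x.snd < N := by
  simp only [box, mem_iUnion, mem_Iio, exists_prop, mem_range]
  constructor
  · rintro ⟨i, hi, j, hj, t, h⟩
    obtain rfl := emb_injective h
    exact ⟨hi, hj⟩
  · exact fun h => ⟨_, h.1, _, h.2, x.mid, rfl⟩

theorem box_mono : Monotone B.box := fun _ _ h =>
  biUnion_mono (Iio_subset_Iio h) fun _ _ => biUnion_subset_biUnion_left (Iio_subset_Iio h)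

end BruckReillyFrame

end Coordinates

/-! ### Propagation in the grid -/

section Steps

/-- A set of pairs which, outside of the square `[0, N)²`, is closed under steps to neighbouring
pairs, contains all or none of the pairs outside of the square. -/
theorem forall_of_steps {Q : ℕ → ℕ → Prop} {N : ℕ}
    (hr : ∀ i j, N ≤ i ∨ N ≤ j → Q i j → Q (i + 1) j)
    (hl : ∀ i j, N ≤ i + 1 ∨ N ≤ j → Q (i + 1) j → Q i j)
    (hu : ∀ i j, N ≤ i ∨ N ≤ j → Q i j → Q i (j + 1))
    (hd : ∀ i j, N ≤ i ∨ N ≤ j + 1 → Q i (j + 1) → Q i j)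
    {i j k l : ℕ} (hij : N ≤ i ∨ N ≤ j) (h : Q i j) (hkl : N ≤ k ∨ N ≤ l) : Q k l := by
  have right (j n i : ℕ) (hj : N ≤ i ∨ N ≤ j) (h : Q i j) : Q (i + n) j := by
    induction n with
    | zero => exact h
    | succ n ih => exact hr (i + n) j (by omega) ih
  have left (j n i : ℕ) (hj : N ≤ i ∨ N ≤ j) (h : Q (i + n) j) : Q i j := by
    induction n with
    | zero => exact h
    | succ n ih => exact ih (hl (i + n) j (by omega) h)
  have up (i n j : ℕ) (hj : N ≤ i ∨ N ≤ j) (h : Q i j) : Q i (j + n) := by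
    induction n with
    | zero => exact h
    | succ n ih => exact hu i (j + n) (by omega) ih
  have down (i n j : ℕ) (hj : N ≤ i ∨ N ≤ j) (h : Q i (j + n)) : Q i j := by
    induction n with
    | zero => exact h
    | succ n ih => exact ih (hd i (j + n) (by omega) h)
  -- move to a pair that is far from the square in both directions, and from there to `(k, l)`
  have h₁ : Q (i + (N + k)) (j + (N + l)) := by
    rcases hij with hi | hj
    · exact right _ _ _ (by omega) (up _ _ _ (by omega) h)
    · exact up _ _ _ (by omega) (right _ _ _ (by omega) h)
  have e₁ : i + (N + k) = k + (i + N) := by omega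
  have e₂ : j + (N + l) = l + (j + N) := by omega
  rw [e₁, e₂] at h₁
  rcases hkl with hk | hl
  · exact down _ _ _ (by omega) (left _ _ _ (by omega) h₁)
  · exact left _ _ _ (by omega) (down _ _ _ (by omega) h₁)

end Steps

/-! ### Topological Bruck--Reilly extensions -/

section TopologicalExtension

namespace StrongSemilattice

variable {E : Type v} [SemilatticeInf E] {G : E → Type u} [∀ α, Group (G α)]
  {φ : ConnectingHoms E G}

variable (φ) in
/-- The element `a ∈ G α` as an element of the strong semilattice. -/
abbrev mk (α : E) (a : G α) : StrongSemilattice φ := Sigma.mk α a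

theorem mk_mul_mk (α : E) (a b : G α) : mk φ α a * mk φ α b = mk φ α (a * b) := by
  refine ext' (inf_idem α) ?_
  change φ.map _ (φ.map _ a * φ.map _ b) = a * b
  simp only [map_mul, φ.map_map, φ.map_self]

theorem isInverseOf_iff (x y : StrongSemilattice φ) : IsInverseOf x y ↔ y = mk φ x.1 x.2⁻¹ := by
  obtain ⟨α, a⟩ := x
  obtain ⟨β, b⟩ := y
  constructor
  · rintro ⟨h₁, h₂⟩
    have e₁ : α ⊓ β ⊓ α = α := congrArg Sigma.fst h₁
    have e₂ : β ⊓ α ⊓ β = β := congrArg Sigma.fst h₂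
    obtain rfl : α = β := le_antisymm
      (e₁.ge.trans (inf_le_left.trans inf_le_right)) (e₂.ge.trans (inf_le_left.trans inf_le_right))
    change mk φ α a * mk φ α b * mk φ α a = mk φ α a at h₁
    rw [mk_mul_mk, mk_mul_mk] at h₁
    have h : a * b * a = a := eq_of_heq (Sigma.mk.inj h₁).2
    have hab : a * b = 1 := by simpa using h
    exact congrArg (Sigma.mk α) (eq_inv_of_mul_eq_one_right hab)
  · intro h
    obtain ⟨rfl, h⟩ := Sigma.mk.inj h
    obtain rfl := eq_of_heq h
    constructor
    · change mk φ β a * mk φ β a⁻¹ * mk φ β a = mk φ β a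
      rw [mk_mul_mk, mk_mul_mk, mul_inv_cancel, one_mul]
    · change mk φ β a⁻¹ * mk φ β a * mk φ β a⁻¹ = mk φ β a⁻¹
      rw [mk_mul_mk, mk_mul_mk, inv_mul_cancel, one_mul]

variable [∀ α, TopologicalSpace (G α)]

instance [∀ α, T2Space (G α)] : T2Space (StrongSemilattice φ) :=
  inferInstanceAs (T2Space (Σ α, G α))

variable (φ) in
theorem continuous_mk (α : E) : Continuous (mk φ α) := continuous_sigmaMk

theorem isTopologicalInverseSemigroup [∀ α, IsTopologicalGroup (G α)] [OrderTop E]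
    (hφ : ∀ {α β : E} (h : β ≤ α), Continuous (φ.map h)) :
    IsTopologicalInverseSemigroup (StrongSemilattice φ) := by
  refine ⟨⟨continuous_iff_continuousAt.2 ?_⟩,
    fun x => mk φ x.1 x.2⁻¹, ?_, isInverseOf_iff⟩
  · rintro ⟨⟨α, a⟩, ⟨β, b⟩⟩
    have hemb : IsOpenEmbedding (Prod.map (Sigma.mk α : G α → Σ α, G α)
        (Sigma.mk β : G β → Σ α, G α)) := 
      IsOpenEmbedding.sigmaMk.prodMap IsOpenEmbedding.sigmaMk
    refine (hemb.continuousAt_iff (x := (a, b))).1 (Continuous.continuousAt ?_)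
    exact (continuous_mk φ (α ⊓ β)).comp
      (((hφ inf_le_left).comp continuous_fst).mul ((hφ inf_le_right).comp continuous_snd))
  · exact continuous_sigma fun α => (continuous_mk φ α).comp continuous_inv

end StrongSemilattice

namespace BruckReilly

variable {T : Type u} [Monoid T] {θ : T →* Tˣ}

theorem isInverseOf_mk {i j : ℕ} {s t : T} (h : IsInverseOf s t) :
    IsInverseOf (⟨i, s, j⟩ : BruckReilly θ) ⟨j, t, i⟩ := by
  have hmul (i j k : ℕ) (s t : T) :
      (⟨i, s, j⟩ : BruckReilly θ) * ⟨j, t, k⟩ = ⟨i, s * t, k⟩ := by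
    simp [mul_def, iter]
  exact ⟨by rw [hmul, hmul, h.1], by rw [hmul, hmul, h.2]⟩

variable [TopologicalSpace T]

theorem sumDirectTopology_eq_induced :
    sumDirectTopology θ = TopologicalSpace.induced
      (fun x : BruckReilly θ => (x.fst, x.mid, x.snd)) inferInstance := by
  refine le_antisymm ?_ (le_generateFrom ?_)
  · have hblock (U : Set T) (hU : IsOpen U) (i j : ℕ) :
        IsOpen[sumDirectTopology θ] (block θ U i j) :=
      TopologicalSpace.isOpen_generateFrom_of_mem ⟨U, hU, i, j, rfl⟩
    let _ := sumDirectTopology θ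
    refine continuous_iff_le_induced.1 (Continuous.prodMk ?_ (Continuous.prodMk ?_ ?_))
    · refine ⟨fun A _ => ?_⟩
      have : (fun x : BruckReilly θ => x.fst) ⁻¹' A = ⋃ i ∈ A, ⋃ j, block θ univ i j := by
        ext x
        simp [block]
      rw [this]
      exact isOpen_biUnion fun i _ => isOpen_iUnion fun j => hblock _ isOpen_univ i j
    · refine ⟨fun U hU => ?_⟩
      have : (fun x : BruckReilly θ => x.mid) ⁻¹' U = ⋃ i, ⋃ j, block θ U i j := by
        ext x
        simp [block]
      rw [this]
      exact isOpen_iUnion fun i => isOpen_iUnion fun j => hblock _ hU i j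
    · refine ⟨fun A _ => ?_⟩
      have : (fun x : BruckReilly θ => x.snd) ⁻¹' A = ⋃ j ∈ A, ⋃ i, block θ univ i j := by
        ext x
        simp [block]
      rw [this]
      exact isOpen_biUnion fun j _ => isOpen_iUnion fun i => hblock _ isOpen_univ i j
  · rintro _ ⟨U, hU, i, j, rfl⟩
    refine isOpen_induced_iff.2 ⟨{i} ×ˢ U ×ˢ {j}, ?_, ?_⟩
    · exact (isOpen_discrete _).prod (hU.prod (isOpen_discrete _))
    · ext x
      simp [block]

theorem continuous_iter (hθ : Continuous fun t : T => (θ t : T)) (n : ℕ) :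
    Continuous (iter θ n) := hθ.iterate n

/-- Since `ℕ` is discrete, `BR(T, θ)` with the sum direct topology is the topological sum of copies
of `T`, on each of which the operations are continuous. -/
theorem isTopologicalExtension [T2Space T] (hT : IsTopologicalInverseSemigroup T)
    (hθ : Continuous fun t : T => (θ t : T)) (hBR : IsInverseSemigroup (BruckReilly θ)) :
    @IsTopologicalExtension T _ _ θ (sumDirectTopology θ) := by
  let _ := sumDirectTopology θ
  have hind : IsInducing (fun x : BruckReilly θ => (x.fst, x.mid, x.snd)) :=
    ⟨sumDirectTopology_eq_induced⟩
  have hinj : Function.Injective (fun x : BruckReilly θ => (x.fst, x.mid, x.snd)) := by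
    intro x y h
    simp only [Prod.mk.injEq] at h
    exact BruckReilly.ext h.1 h.2.1 h.2.2
  have hfst : Continuous fun x : BruckReilly θ => x.fst := continuous_fst.comp hind.continuous
  have hmid : Continuous fun x : BruckReilly θ => x.mid :=
    (continuous_fst.comp continuous_snd).comp hind.continuous
  have hsnd : Continuous fun x : BruckReilly θ => x.snd :=
    (continuous_snd.comp continuous_snd).comp hind.continuous
  have hiter : Continuous fun z : ℕ × T => iter θ z.1 z.2 :=
    continuous_prod_of_discrete_left.2 (continuous_iter hθ)
  have hT' := hT
  obtain ⟨hmulT, inv, hinv, hinv_iff⟩ := hT'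
  refine ⟨⟨inferInstance, hT⟩, ⟨T2Space.of_injective_continuous hinj hind.continuous,
    ⟨⟨?_⟩, fun x => ⟨x.snd, inv x.mid, x.fst⟩, ?_, ?_⟩⟩, 0, ?_⟩
  · refine hind.continuous_iff.2 ?_
    have h₁ := hfst.comp (continuous_fst (X := BruckReilly θ) (Y := BruckReilly θ))
    have h₂ := hsnd.comp (continuous_fst (X := BruckReilly θ) (Y := BruckReilly θ))
    have h₃ := hfst.comp (continuous_snd (X := BruckReilly θ) (Y := BruckReilly θ))
    have h₄ := hsnd.comp (continuous_snd (X := BruckReilly θ) (Y := BruckReilly θ))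
    have hd (f : ℕ × ℕ × ℕ → ℕ) : Continuous f := continuous_of_discreteTopology
    refine Continuous.prodMk ?_ (Continuous.prodMk (Continuous.mul ?_ ?_) ?_)
    · exact (hd fun z => z.1 + z.2.2 - min z.2.1 z.2.2).comp (h₁.prodMk (h₂.prodMk h₃))
    · exact hiter.comp (((hd fun z => z.2.2 - min z.2.1 z.2.2).comp
        (h₁.prodMk (h₂.prodMk h₃))).prodMk (hmid.comp continuous_fst))
    · exact hiter.comp (((hd fun z => z.2.1 - min z.2.1 z.2.2).comp
        (h₁.prodMk (h₂.prodMk h₃))).prodMk (hmid.comp continuous_snd))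
    · exact (hd fun z => z.1 + z.2.2 - min z.1 z.2.1).comp (h₂.prodMk (h₃.prodMk h₄))
  · exact hind.continuous_iff.2 (hsnd.prodMk ((hinv.comp hmid).prodMk hfst))
  · intro x y
    have hx : IsInverseOf x ⟨x.snd, inv x.mid, x.fst⟩ :=
      isInverseOf_mk ((hinv_iff x.mid _).2 rfl)
    refine ⟨fun h => (hBR x).unique h hx, ?_⟩
    rintro rfl
    exact hx
  · have hc : Continuous fun t : T => (⟨0, t, 0⟩ : BruckReilly θ) :=
      hind.continuous_iff.2 (continuous_const.prodMk (continuous_id.prodMk continuous_const))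
    exact IsEmbedding.of_comp hc hmid IsEmbedding.id

end BruckReilly

end TopologicalExtension

/-! ### Green's relation `ℋ` -/

section GreenClasses

theorem leftIdeal_subset {S : Type*} [Semigroup S] {a b c : S} (h : b = c * a) :
    leftIdeal b ⊆ leftIdeal a := by
  rintro x (rfl | ⟨s, rfl⟩)
  · exact Or.inr ⟨c, h⟩
  · exact Or.inr ⟨s * c, by rw [h, mul_assoc]⟩

theorem rightIdeal_subset {S : Type*} [Semigroup S] {a b c : S} (h : b = a * c) :
    rightIdeal b ⊆ rightIdeal a := by
  rintro x (rfl | ⟨s, rfl⟩)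
  · exact Or.inr ⟨c, h⟩
  · exact Or.inr ⟨c * s, by rw [h, mul_assoc]⟩

theorem mem_leftIdeal_self {S : Type*} [Mul S] (a : S) : a ∈ leftIdeal a := Or.inl rfl

theorem mem_rightIdeal_self {S : Type*} [Mul S] (a : S) : a ∈ rightIdeal a := Or.inl rfl

theorem hClass_eq_preimage {S S' : Type*} [Mul S] [Mul S'] (f : S ≃* S') (a : S) :
    hClass a = f ⁻¹' hClass (f a) := by
  have hl (b : S) : leftIdeal b = f ⁻¹' leftIdeal (f b) := by
    ext x
    constructor
    · rintro (rfl | ⟨s, rfl⟩)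
      · exact Or.inl rfl
      · exact Or.inr ⟨f s, map_mul f s b⟩
    · rintro (h | ⟨s, h⟩)
      · exact Or.inl (f.injective h)
      · exact Or.inr ⟨f.symm s, f.injective (by rw [h, map_mul, f.apply_symm_apply])⟩
  have hr (b : S) : rightIdeal b = f ⁻¹' rightIdeal (f b) := by
    ext x
    constructor
    · rintro (rfl | ⟨s, rfl⟩)
      · exact Or.inl rfl
      · exact Or.inr ⟨f s, map_mul f b s⟩
    · rintro (h | ⟨s, h⟩)
      · exact Or.inl (f.injective h)
      · exact Or.inr ⟨f.symm s, f.injective (by rw [h, map_mul, f.apply_symm_apply])⟩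
  ext b
  simp only [hClass, mem_ofPred_eq, mem_preimage, hl, hr, f.surjective.preimage_injective.eq_iff]

theorem hClass_zero (S : Type*) [SemigroupWithZero S] : hClass (0 : S) = {0} := by
  ext b
  constructor
  · rintro ⟨h, -⟩
    have : b ∈ leftIdeal (0 : S) := h ▸ mem_leftIdeal_self b
    simpa [leftIdeal] using this
  · rintro rfl
    exact ⟨rfl, rfl⟩

namespace OmegaFrame

variable {S : Type u} [SemigroupWithZero S] {C : OmegaFrame S} {x : S} {m n : ℕ}

theorem hClass_eq (hx : x ∈ C.H m n) : hClass x = C.H m n := by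
  ext y
  constructor
  · rintro ⟨hl, hr⟩
    have hy : y ≠ 0 := by
      rintro rfl
      have : x ∈ leftIdeal (0 : S) := hl ▸ mem_leftIdeal_self x
      exact ne_zero_of_mem hx (by simpa [leftIdeal] using this)
    obtain ⟨k, l, hkl⟩ := C.exists_mem_H hy
    have hleft {a b : S} {i j i' j' : ℕ} (ha : a ∈ C.H i j) (hb : b ∈ C.H i' j')
        (h : a ∈ leftIdeal b) : j' ≤ j := by
      rw [← mul_e_iff ha]
      rcases h with rfl | ⟨s, rfl⟩
      · exact mul_e hb le_rfl
      · rw [mul_assoc, mul_e hb le_rfl]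
    have hright {a b : S} {i j i' j' : ℕ} (ha : a ∈ C.H i j) (hb : b ∈ C.H i' j')
        (h : a ∈ rightIdeal b) : i' ≤ i := by
      rw [← e_mul_iff ha]
      rcases h with rfl | ⟨s, rfl⟩
      · exact e_mul hb le_rfl
      · rw [← mul_assoc, e_mul hb le_rfl]
    obtain rfl := (hleft hkl hx (hl ▸ mem_leftIdeal_self y)).antisymm
      (hleft hx hkl (hl.symm ▸ mem_leftIdeal_self x))
    obtain rfl := (hright hkl hx (hr ▸ mem_rightIdeal_self y)).antisymm
      (hright hx hkl (hr.symm ▸ mem_rightIdeal_self x))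
    exact hkl
  · intro hy
    have hl {a b : S} (ha : a ∈ C.H m n) (hb : b ∈ C.H m n) : leftIdeal a ⊆ leftIdeal b :=
      leftIdeal_subset (c := a * C.inv b) (by rw [mul_assoc, hb.2, mul_e ha le_rfl])
    have hr {a b : S} (ha : a ∈ C.H m n) (hb : b ∈ C.H m n) : rightIdeal a ⊆ rightIdeal b :=
      rightIdeal_subset (c := C.inv b * a) (by rw [← mul_assoc, hb.1, e_mul ha le_rfl])
    exact ⟨(hl hy hx).antisymm (hl hx hy), (hr hy hx).antisymm (hr hx hy)⟩

theorem isMaximalSubgroup_H (C : OmegaFrame S) (n : ℕ) : IsMaximalSubgroup (C.H n n) := by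
  refine ⟨⟨fun x hx y hy => mul_mem hx hy, C.e n, e_mem C n,
    fun x hx => ⟨e_mul hx le_rfl, mul_e hx le_rfl⟩, fun x hx => ⟨C.inv x, inv_mem hx, hx⟩⟩, ?_⟩
  rintro A ⟨-, f, -, hfA, hinvA⟩ hle x hx
  -- the identity `f` of a subgroup containing the idempotent `e n` is `e n`
  have hf : f = C.e n := by
    obtain ⟨y, -, hy, -⟩ := hinvA _ (hle (e_mem C n))
    rw [← (hfA _ (hle (e_mem C n))).2, ← hy, ← mul_assoc, e_idem]
  subst hf
  obtain ⟨y, hyA, hxy, hyx⟩ := hinvA x hx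
  exact mem_H_of hxy hyx (hfA x hx).2 (hfA y hyA).1

end OmegaFrame

end GreenClasses

/-! ### Compactness and openness of the `ℋ`-classes -/

section CompactSubgroups

namespace OmegaFrame

variable {S : Type u} [SemigroupWithZero S] [TopologicalSpace S]
  [SeparatelyContinuousMul S] (C : OmegaFrame S)

theorem isCompact_H (hcpt : ∀ A : Set S, IsMaximalSubgroup A → IsCompact A) (m n : ℕ) :
    IsCompact (C.H m n) := by
  rcases (C.H m n).eq_empty_or_nonempty with h | ⟨x, hx⟩
  · rw [h]
    exact isCompact_empty
  · have : C.H m n = (x * ·) '' C.H n n := by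
      refine Subset.antisymm (fun y hy => ⟨C.inv x * y, mul_mem (inv_mem hx) hy, ?_⟩) ?_
      · change x * (C.inv x * y) = y
        rw [← mul_assoc, hx.1, e_mul hy le_rfl]
      · rintro _ ⟨y, hy, rfl⟩
        exact mul_mem hx hy
    rw [this]
    exact (hcpt _ (C.isMaximalSubgroup_H n)).image (continuous_const_mul x)

variable [T2Space S]

/-- The elements of classes `H k l` with `k ≤ m` and `l ≤ n` are those which are moved by both
`e (m + 1)` and `e (n + 1)`, an open condition; there are finitely many such classes, all of them
closed. -/
theorem isOpen_H (hcpt : ∀ A : Set S, IsMaximalSubgroup A → IsCompact A) (m n : ℕ) :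
    IsOpen (C.H m n) := by
  let I : Set (ℕ × ℕ) := (Iic m ×ˢ Iic n) \ {(m, n)}
  have hI : I.Finite := ((finite_Iic m).prod (finite_Iic n)).sdiff
  have : C.H m n = {x | C.e (m + 1) * x ≠ x} ∩ {x | x * C.e (n + 1) ≠ x} ∩
      (⋃ i ∈ I, C.H i.1 i.2)ᶜ := by
    ext x
    constructor
    · intro hx
      refine ⟨⟨fun h => ?_, fun h => ?_⟩, fun h => ?_⟩
      · have := (e_mul_iff hx).1 h
        omega
      · have := (mul_e_iff hx).1 h
        omega
      · obtain ⟨i, hi, hxi⟩ := mem_iUnion₂.1 h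
        have := eq_of_mem_of_mem hx hxi
        exact hi.2 (Prod.ext this.1.symm this.2.symm)
    · rintro ⟨⟨h₁, h₂⟩, h₃⟩
      obtain ⟨k, l, hkl⟩ := C.exists_mem_H (x := x) (by
        rintro rfl
        exact h₁ (mul_zero _))
      have hk : k ≤ m := by
        by_contra! hlt
        exact h₁ (e_mul hkl hlt)
      have hl : l ≤ n := by
        by_contra! hlt
        exact h₂ (mul_e hkl hlt)
      by_contra hx
      refine h₃ (mem_iUnion₂.2 ⟨(k, l), ⟨⟨hk, hl⟩, fun h => hx ?_⟩, hkl⟩)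
      obtain ⟨rfl, rfl⟩ := Prod.mk.inj h
      exact hkl
  rw [this]
  refine ((isOpen_ne_fun (continuous_const_mul _) continuous_id).inter
    (isOpen_ne_fun (continuous_mul_const _) continuous_id)).inter ?_
  exact (hI.isClosed_biUnion fun i _ => (C.isCompact_H hcpt i.1 i.2).isClosed).isOpen_compl

theorem isTopologicalGroup_maxGroup (hcpt : ∀ A : Set S, IsMaximalSubgroup A → IsCompact A)
    (n : ℕ) : IsTopologicalGroup (C.MaxGroup n) := by
  have : CompactSpace (C.MaxGroup n) := isCompact_iff_compactSpace.1 (C.isCompact_H hcpt n n)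
  have : SeparatelyContinuousMul (C.MaxGroup n) :=
    ⟨fun {a} => ((continuous_const_mul (a : S)).comp continuous_subtype_val).subtype_mk _,
     fun {a} => ((continuous_mul_const (a : S)).comp continuous_subtype_val).subtype_mk _⟩
  exact isTopologicalGroup_of_compact

end OmegaFrame

end CompactSubgroups

/-! ### The topology of the extension -/

section Topology

namespace BruckReillyFrame

open OmegaFrame

variable {S : Type u} [SemigroupWithZero S] [TopologicalSpace S] {B : BruckReillyFrame S}

theorem continuous_val : Continuous (val (B := B)) :=
  continuous_sigma fun _ => continuous_subtype_val

variable [SeparatelyContinuousMul S]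

theorem continuous_connecting {α β : B.Index} (h : β ≤ α) : Continuous (B.connecting.map h) :=
  ((continuous_const_mul (B.e (B.num β))).comp continuous_subtype_val).subtype_mk _

theorem continuous_theta : Continuous fun t : B.Base => (B.theta t : B.Base) :=
  (StrongSemilattice.continuous_mk B.connecting ⊤).comp <| Continuous.subtype_mk
    ((continuous_mul_const (B.qPow 1)).comp
      ((continuous_const_mul (B.pPow 1)).comp continuous_val)) _

theorem continuous_emb :
    @Continuous _ _ (BruckReilly.sumDirectTopology B.theta) _ (emb (B := B)) := by
  rw [BruckReilly.sumDirectTopology_eq_induced]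
  have h : Continuous fun z : ℕ × B.Base × ℕ => B.qPow z.1 * val z.2.1 * B.pPow z.2.2 := by
    refine continuous_prod_of_discrete_left.2 fun i =>
      continuous_prod_of_discrete_right.2 fun j => ?_
    exact (continuous_mul_const (B.pPow j)).comp
      ((continuous_const_mul (B.qPow i)).comp continuous_val)
  let f : BruckReilly B.theta → ℕ × B.Base × ℕ := fun x => (x.fst, x.mid, x.snd)
  let _ : TopologicalSpace (BruckReilly B.theta) := TopologicalSpace.induced f inferInstance
  exact h.comp (continuous_induced_dom (f := f))

theorem isCompact_box (hcpt : ∀ A : Set S, IsMaximalSubgroup A → IsCompact A) (N : ℕ) :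
    IsCompact (B.box N) := by
  have (α : B.Index) : CompactSpace (B.MaxGroup (B.num α)) :=
    isCompact_iff_compactSpace.1 (B.isCompact_H hcpt _ _)
  have : CompactSpace B.Base := inferInstanceAs (CompactSpace (Σ α, B.MaxGroup (B.num α)))
  refine (finite_Iio N).isCompact_biUnion fun i _ => (finite_Iio N).isCompact_biUnion fun j _ => ?_
  exact isCompact_range (f := fun t : B.Base => B.qPow i * val t * B.pPow j)
    ((continuous_mul_const _).comp ((continuous_const_mul _).comp continuous_val))

variable [T2Space S]

theorem isOpenMap_val (hcpt : ∀ A : Set S, IsMaximalSubgroup A → IsCompact A) :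
    IsOpenMap (val (B := B)) :=
  isOpenMap_sigma.2 fun α => (B.isOpen_H hcpt (B.num α) (B.num α)).isOpenMap_subtype_val

theorem induced_emb (hcpt : ∀ A : Set S, IsMaximalSubgroup A → IsCompact A) :
    TopologicalSpace.induced (emb (B := B)) inferInstance =
      BruckReilly.sumDirectTopology B.theta := by
  refine le_antisymm (le_generateFrom ?_) (continuous_iff_le_induced.1 continuous_emb)
  rintro _ ⟨U, hU, i, j, rfl⟩
  refine isOpen_induced_iff.2 ⟨(⋃ r ∈ Iio B.d, B.H (i * B.d + r) (j * B.d + r)) ∩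
    (fun x => B.pPow i * x * B.qPow j) ⁻¹' (val '' U), ?_, ?_⟩
  · refine (isOpen_biUnion fun r _ => B.isOpen_H hcpt _ _).inter ?_
    exact (isOpenMap_val hcpt U hU).preimage
      ((continuous_mul_const (B.qPow j)).comp (continuous_const_mul (B.pPow i)))
  · ext ⟨k, t, l⟩
    constructor
    · rintro ⟨hH, s, hs, hst⟩
      obtain ⟨r, hr, hx⟩ := mem_iUnion₂.1 hH
      have h := eq_of_mem_of_mem (emb_mem _) hx
      obtain ⟨rfl, -⟩ := B.eq_of_index_eq (num_lt _) hr h.1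
      obtain ⟨rfl, -⟩ := B.eq_of_index_eq (num_lt _) hr h.2
      have hst' : val s = B.pPow k * (B.qPow k * val t * B.pPow l) * B.qPow l := hst
      rw [B.pPow_qPow_cancel] at hst'
      exact ⟨rfl, val_injective hst' ▸ hs, rfl⟩
    · rintro ⟨rfl, ht, rfl⟩
      exact ⟨mem_iUnion₂.2 ⟨_, num_lt t, emb_mem _⟩, t, ht, (B.pPow_qPow_cancel _ _ _).symm⟩

theorem isOpen_box (hcpt : ∀ A : Set S, IsMaximalSubgroup A → IsCompact A) (N : ℕ) :
    IsOpen (B.box N) := by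
  refine isOpen_biUnion fun i _ => isOpen_biUnion fun j _ => ?_
  have : (range fun t : B.Base => emb (⟨i, t, j⟩ : BruckReilly B.theta)) =
      ⋃ α : B.Index, B.H (i * B.d + B.num α) (j * B.d + B.num α) := by
    ext x
    simp only [mem_range, mem_iUnion]
    constructor
    · rintro ⟨t, rfl⟩
      exact ⟨t.1, emb_mem _⟩
    · rintro ⟨α, hx⟩
      obtain ⟨t, ht⟩ := exists_val_eq (OrderDual.ofDual α).2 (B.pPow_mul_mul_qPow_mem hx)
      exact ⟨t, by rw [emb, ht, B.qPow_pPow_cancel hx]⟩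
  rw [this]
  exact isOpen_iUnion fun α => B.isOpen_H hcpt _ _

/-- A compact set is contained in every neighbourhood of `0`, up to finitely many `ℋ`-classes. -/
theorem exists_box {K W : Set S} (hcpt : ∀ A : Set S, IsMaximalSubgroup A → IsCompact A)
    (hK : IsCompact K) (hW : W ∈ 𝓝 (0 : S)) : ∃ N, K \ B.box N ⊆ W := by
  obtain ⟨N, hN⟩ := (hK.diff (isOpen_interior (s := W))).elim_directed_cover B.box
    (B.isOpen_box hcpt) (by
      rintro x ⟨-, hx⟩
      obtain ⟨y, rfl⟩ := exists_emb_eq (B := B) (x := x) (by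
        rintro rfl
        exact hx (mem_interior_iff_mem_nhds.2 hW))
      exact mem_iUnion.2 ⟨max y.fst y.snd + 1, (emb_mem_box y).2 ⟨by omega, by omega⟩⟩)
    B.box_mono.directed_le
  refine ⟨N, fun x hx => by_contra fun hxW => hx.2 (hN ⟨hx.1, fun h => hxW (interior_subset h)⟩)⟩

/-- If `0` is not isolated, every compact neighbourhood `K` of `0` contains all but finitely many
`ℋ`-classes. Multiplication by `p` and `p⁻¹` on either side shows that whether `p⁻ⁱ t pʲ` is in `K`
depends only on `t`, outside of a finite set of pairs `(i, j)`. So `p⁻ⁱ t` tends to `0` for some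
`t`; multiplying by `p⁻¹ θ(t)⁻¹ s` on the right, `p⁻⁽ⁱ⁺¹⁾ s` tends to `0` for all `s`. -/
theorem compactSpace_of_not_isOpen_zero [LocallyCompactSpace S] (B : BruckReillyFrame S)
    (hcpt : ∀ A : Set S, IsMaximalSubgroup A → IsCompact A) (h0 : ¬IsOpen ({0} : Set S)) :
    CompactSpace S := by
  obtain ⟨K, hK, hK0⟩ := exists_compact_mem_nhds (0 : S)
  have hleft (a : S) : (a * ·) ⁻¹' K ∈ 𝓝 (0 : S) :=
    (continuous_const_mul a).continuousAt.preimage_mem_nhds (by rwa [mul_zero])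
  have hright (a : S) : (· * a) ⁻¹' K ∈ 𝓝 (0 : S) :=
    (continuous_mul_const a).continuousAt.preimage_mem_nhds (by rwa [zero_mul])
  obtain ⟨N, hN⟩ := exists_box (B := B) hcpt hK (inter_mem
    (inter_mem (hleft (B.qPow 1)) (hleft (B.pPow 1)))
    (inter_mem (hright (B.pPow 1)) (hright (B.qPow 1))))
  have hout {i j : ℕ} (t : B.Base) (hij : N ≤ i ∨ N ≤ j)
      (h : emb (⟨i, t, j⟩ : BruckReilly B.theta) ∈ K) := hN ⟨h, fun hb => by
    have := (emb_mem_box _).1 hb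
    dsimp only at this
    omega⟩
  have hconst (t : B.Base) {i j k l : ℕ} (hij : N ≤ i ∨ N ≤ j)
      (h : emb (⟨i, t, j⟩ : BruckReilly B.theta) ∈ K) (hkl : N ≤ k ∨ N ≤ l) :
      emb (⟨k, t, l⟩ : BruckReilly B.theta) ∈ K := by
    refine forall_of_steps (Q := fun i j => emb (⟨i, t, j⟩ : BruckReilly B.theta) ∈ K) (N := N)
      (fun i j hij h => ?_) (fun i j hij h => ?_) (fun i j hij h => ?_) (fun i j hij h => ?_)
      hij h hkl
    · rw [← qPow_one_mul_emb]
      exact (hout t hij h).1.1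
    · rw [← pPow_one_mul_emb]
      exact (hout t hij h).1.2
    · rw [← emb_mul_pPow_one]
      exact (hout t hij h).2.1
    · rw [← emb_mul_qPow_one]
      exact (hout t hij h).2.2
  obtain ⟨t, ht⟩ : ∃ t : B.Base, ∀ i, N ≤ i → emb (⟨i, t, 0⟩ : BruckReilly B.theta) ∈ K := by
    have hW : interior K \ B.box N ≠ {0} := fun h =>
      h0 (h ▸ isOpen_interior.sdiff (isCompact_box hcpt N).isClosed)
    have h0W : (0 : S) ∈ interior K \ B.box N := by
      refine ⟨mem_interior_iff_mem_nhds.2 hK0, fun h => ?_⟩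
      simp only [box, mem_iUnion] at h
      obtain ⟨i, -, j, -, t, h⟩ := h
      exact emb_ne_zero _ h
    obtain ⟨x, hx, hx0⟩ : ∃ x ∈ interior K \ B.box N, x ≠ 0 := by
      by_contra! hall
      exact hW (Subset.antisymm hall (singleton_subset_iff.2 h0W))
    obtain ⟨⟨i, t, j⟩, rfl⟩ := exists_emb_eq (B := B) hx0
    refine ⟨t, fun k hk => hconst t ?_ (interior_subset hx.1) (Or.inl hk)⟩
    have : ¬(i < N ∧ j < N) := fun h => hx.2 ((emb_mem_box _).2 h)
    omega
  have hall (s : B.Base) {k l : ℕ} (hkl : N ≤ k ∨ N ≤ l) :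
      emb (⟨k, s, l⟩ : BruckReilly B.theta) ∈ K := by
    let c : BruckReilly B.theta := ⟨1, ((B.theta t)⁻¹ : B.Baseˣ) * s, 0⟩
    have hc (i : ℕ) : (⟨i, t, 0⟩ : BruckReilly B.theta) * c = ⟨i + 1, s, 0⟩ := by
      simp [c, BruckReilly.mul_def, BruckReilly.iter]
    obtain ⟨M, hM⟩ := exists_box (B := B) hcpt hK (hright (emb c))
    have hmem := hM ⟨ht (max M N) (le_max_right _ _), fun hb =>
      (((emb_mem_box _).1 hb).1.trans_le (le_max_left M N)).false⟩
    rw [mem_preimage, ← emb_mul, hc] at hmem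
    exact hconst s (by omega) hmem hkl
  have : (univ : Set S) = K ∪ B.box N := by
    refine (eq_univ_of_forall fun x => ?_).symm
    by_cases hx : x = 0
    · exact Or.inl (hx ▸ mem_of_mem_nhds hK0)
    · obtain ⟨y, rfl⟩ := exists_emb_eq (B := B) hx
      by_cases hy : y.fst < N ∧ y.snd < N
      · exact Or.inr ((emb_mem_box y).2 hy)
      · exact Or.inl (hall y.mid (by omega))
  exact isCompact_univ_iff.1 (this ▸ hK.union (isCompact_box hcpt N))

end BruckReillyFrame

end Topology

end OmegaSemigroup

open OmegaSemigroup in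
theorem theorem3p14 {S : Type u} [SemigroupWithZero S] [TopologicalSpace S] [T2Space S]
    [SeparatelyContinuousMul S] (hS : IsZeroSimpleInverseOmegaSemigroup S)
    (hcpt : ∀ A : Set S, IsMaximalSubgroup A → IsCompact A) :
    ∃ (E : Type) (_ : SemilatticeInf E) (_ : OrderTop E) (G : E → Type u)
      (_ : ∀ α, Group (G α)) (_ : ∀ α, TopologicalSpace (G α))
      (φ : ConnectingHoms E G) (θ : StrongSemilattice φ →* (StrongSemilattice φ)ˣ)
      (τ : TopologicalSpace (WithZero (BruckReilly θ))),
      Finite E ∧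
      (∀ α, IsTopologicalGroup (G α) ∧ CompactSpace (G α) ∧ T2Space (G α)) ∧
      Nonempty (S ≃ₜ* WithZero (BruckReilly θ)) ∧
      TopologicalSpace.induced (fun x : BruckReilly θ => (x : WithZero (BruckReilly θ))) τ =
        BruckReilly.sumDirectTopology θ ∧
      @BruckReilly.IsTopologicalExtension _ _ _ θ (BruckReilly.sumDirectTopology θ) ∧
      (LocallyCompactSpace S →
        CompactSpace (WithZero (BruckReilly θ)) ∨
          ∀ x : WithZero (BruckReilly θ), IsOpen (hClass x) ∧ IsCompact (hClass x)) := by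
  obtain ⟨B⟩ := hS.nonempty_bruckReillyFrame
  have hgrp (α : B.Index) : IsTopologicalGroup (B.MaxGroup (B.num α)) :=
    B.isTopologicalGroup_maxGroup hcpt _
  let τ : TopologicalSpace (WithZero (BruckReilly B.theta)) :=
    TopologicalSpace.induced B.equiv inferInstance
  let h : WithZero (BruckReilly B.theta) ≃ₜ S := B.equiv.toEquiv.toHomeomorphOfIsInducing ⟨rfl⟩
  refine ⟨B.Index, inferInstance, inferInstance, fun α => B.MaxGroup (B.num α), inferInstance,
    inferInstance, B.connecting, B.theta, τ, inferInstance, fun α => ⟨hgrp α,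
      isCompact_iff_compactSpace.1 (B.isCompact_H hcpt _ _), inferInstance⟩,
    ⟨{ B.equiv.symm with
        continuous_toFun := h.symm.continuous
        continuous_invFun := h.continuous }⟩, ?_, ?_, fun hloc => ?_⟩
  · rw [induced_compose]
    exact BruckReillyFrame.induced_emb hcpt
  · exact BruckReilly.isTopologicalExtension
      (StrongSemilattice.isTopologicalInverseSemigroup BruckReillyFrame.continuous_connecting)
      BruckReillyFrame.continuous_theta B.isInverseSemigroup
  · by_cases h0 : IsOpen ({0} : Set S)
    · refine Or.inr fun x => ?_
      have hclass : IsOpen (hClass (B.equiv x)) ∧ IsCompact (hClass (B.equiv x)) := by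
        by_cases hx : B.equiv x = 0
        · rw [hx, hClass_zero]
          exact ⟨h0, isCompact_singleton⟩
        · obtain ⟨m, n, hmn⟩ := B.exists_mem_H hx
          rw [OmegaFrame.hClass_eq hmn]
          exact ⟨B.isOpen_H hcpt m n, B.isCompact_H hcpt m n⟩
      rw [hClass_eq_preimage B.equiv x]
      exact ⟨hclass.1.preimage h.continuous, h.isCompact_preimage.2 hclass.2⟩
    · have := B.compactSpace_of_not_isOpen_zero hcpt h0
      exact Or.inl h.symm.compactSpace
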